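/- Let $(M_1,Q_1),\dots,(M_n,Q_n)$ be complex manifolds with $C^\infty$ Hermitian metrics, $\dim_{\mathbb C}M_l=m_l$, $Q_l(z_l,v_l)=\sum [Q_l]_{\alpha\bar\beta}(z_l)v_l^\alpha\overline{v_l^\beta}$ (for instance the factors of the de Rham decomposition of a simply connected complete reducible Hermitian or Kähler manifold), and let $M=M_1\times\cdots\times M_n$ with projections $\pi_l:M\to M_l$. For $t\in[0,\infty)$ and an integer $k\ge 2$ put, for $(z,v)\in T^{1,0}M$, $$F_{t,k}(z,v)=\frac{1}{\sqrt{1+t}}\sqrt{\sum_{l=1}^nQ_l(\pi_l(z),(\pi_l)_*(v))+t\Big(\sum_{l=1}^nQ_l(\pi_l(z),(\pi_l)_*(v))^k\Big)^{1/k}} .$$ For a complex Finsler metric $F$ on a complex manifold, let $G=F^2$, let $(z^\alpha,v^\alpha)$ be local holomorphic coordinates on $T^{1,0}M$ induced by coordinates $z^\alpha$ of the manifold, let $(G^{\bar\tau\alpha})$ be the inverse of the matrix $G_{\alpha\bar\beta}=\partial^2G/\partial v^\alpha\partial\overline{v^\beta}$, and set $$\Gamma^\alpha_{;\mu}=\sum_\tau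 G^{\bar\tau\alpha}\frac{\partial^2G}{\partial\overline{v^\tau}\,\partial z^\mu},\qquad \delta_{\bar\mu}=\frac{\partial}{\partial\overline{z^\mu}}-\sum_\lambda\overline{\Gamma^\lambda_{;\mu}}\frac{\partial}{\partial\overline{v^\lambda}} .$$ The holomorphic sectional curvature of $F$ along $(z,v)$, $v\ne0$, is $$K_F(z,v)=-\frac{2}{G^2}\sum_{\gamma,\alpha,\mu}\frac{\partial G}{\partial v^\gamma}\,\delta_{\bar\mu}(\Gamma^\gamma_{;\alpha})\,v^\alpha\overline{v^\mu}.$$ Let $K_l$ be the holomorphic sectional curvature of $\sqrt{Q_l}$ and $K_{t,k}$ that of $F_{t,k}$. Suppose that there is a real constant $c$ such that $K_l(z_l,v_l)=c$ for all $l$ and all $v_l\neq0$. Let $k\ge2$ be an integer. Then, for all $(z,v)\in T^{1,0}M$ with $v\ne 0$: (1) if $c>0$, then $\dfrac{(1+t)c}{n+t\,n^{1/k}}\le K_{t,k}(z,v)\le c$ for all $t\ge0$; (2) if $c<0$, then $c\le K_{t,k}(z,v)\le\dfrac{(1+t)c}{n+t\,n^{1/k}}$ for all $t\ge0$; (3)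 if $c=0$, then $K_{t,k}(z,v)=0$ for all $t\ge0$; (4) for every $c\in\mathbb R$, with $Q_l=Q_l(\pi_l(z),(\pi_l)_*(v))$, $$\lim_{t\to0^+}K_{t,k}(z,v)=c\,\frac{\sum_{l=1}^nQ_l^2}{\big(\sum_{l=1}^nQ_l\big)^2},\qquad \lim_{t\to+\infty}K_{t,k}(z,v)=c\,\frac{\sum_{l=1}^nQ_l^{k+1}}{\big(\sum_{l=1}^nQ_l^k\big)^{\frac1k+1}} .$$ -/

import Mathlib

open scoped Manifold ContDiff Topology

noncomputable section

namespace ComplexFinsler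

/-! ### Products of complex manifolds -/

section ProductManifold

variable {ι : Type*} [Fintype ι] {E : ι → Type*} [∀ l, NormedAddCommGroup (E l)]
  [∀ l, NormedSpace ℂ (E l)] {M : ι → Type*} [∀ l, TopologicalSpace (M l)]
  [∀ l, ChartedSpace (E l) (M l)]

/-- A finite product of complex manifolds, with the product charts, is a complex manifold. -/
instance isManifold_pi [∀ l, IsManifold 𝓘(ℂ, E l) ω (M l)] :
    IsManifold (ModelWithCorners.pi fun l => 𝓘(ℂ, E l)) ω (∀ l, M l) := by
  refine isManifold_of_contDiffOn _ _ _ ?_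
  rintro _ _ ⟨e, he, rfl⟩ ⟨e', he', rfl⟩
  rw [contDiffOn_pi]
  intro l
  have hl : ContDiffOn ℂ ω (e' l ∘ (e l).symm) ((e l).symm ≫ₕ e' l).source := by
    have h := ModelWithCorners.contDiffOn_extendCoordChange (I := 𝓘(ℂ, E l)) (n := ω)
      (IsManifold.subset_maximalAtlas (he l trivial))
      (IsManifold.subset_maximalAtlas (he' l trivial))
    simpa [ModelWithCorners.extendCoordChange, mfld_simps] using h
  refine hl.comp (t := _) (f := fun x : ∀ l, E l => x l) (contDiff_pi.1 contDiff_id l).contDiffOn ?_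
  rintro x ⟨hx, -⟩
  exact ⟨hx.1 l trivial, hx.2 l trivial⟩

end ProductManifold

/-! ### Wirtinger derivatives -/

section Wirtinger

variable {V : Type*} [NormedAddCommGroup V] [NormedSpace ℂ V]

/-- The derivative of type `(1,0)` of `f` in the complex direction `w`:
`∂f/∂ζ = (∂f/∂ξ - i ∂f/∂η) / 2` for the coordinate `ζ = ξ + i η` with coordinate vector `w`. -/
def dHol (w : V) (f : V → ℂ) (x : V) : ℂ :=
  (fderiv ℝ f x w - Complex.I * fderiv ℝ f x (Complex.I • w)) / 2

/-- The derivative of type `(0,1)` of `f` in the complex direction `w`: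
`∂f/∂ζ̄ = (∂f/∂ξ + i ∂f/∂η) / 2`. -/
def dBar (w : V) (f : V → ℂ) (x : V) : ℂ :=
  (fderiv ℝ f x w + Complex.I * fderiv ℝ f x (Complex.I • w)) / 2

end Wirtinger

/-! ### The Chern-Finsler connection and its curvature in local coordinates

`E` is the coordinate space of the base, `b` is a basis of `E`, and `(z, v)` in `E × E` stands for
the coordinates `z = ∑ z^α b_α`, `v = ∑ v^α b_α`. -/

section Coordinates

variable {E : Type*} [NormedAddCommGroup E] [NormedSpace ℂ E]
  {κ : Type*} [Fintype κ] [DecidableEq κ] (b : Module.Basis κ ℂ E)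

/-- The coordinate vector of the base coordinate `z^α`. -/
def baseVec (α : κ) : E × E := (b α, 0)

/-- The coordinate vector of the fibre coordinate `v^α`. -/
def fibreVec (α : κ) : E × E := (0, b α)

/-- The Levi matrix `G_{αβ̄} = ∂²G / ∂v^α ∂v̄^β`. -/
def leviMatrix (G : E × E → ℂ) (x : E × E) : Matrix κ κ ℂ :=
  Matrix.of fun α β => dHol (fibreVec b α) (dBar (fibreVec b β) G) x

/-- The Chern-Finsler nonlinear connection coefficients
`Γ^α_{;μ} = ∑_τ G^{τ̄α} ∂²G / ∂v̄^τ ∂z^μ`, where `(G^{τ̄α})` is the inverse of `(G_{αβ̄})`. -/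
def connCoeff (G : E × E → ℂ) (α μ : κ) (x : E × E) : ℂ :=
  ∑ τ, (leviMatrix b G x)⁻¹ τ α * dBar (fibreVec b τ) (dHol (baseVec b μ) G) x

/-- The horizontal derivative
`δ_{μ̄} f = ∂f/∂z̄^μ - ∑_λ conj (Γ^λ_{;μ}) ∂f/∂v̄^λ`. -/
def deltaBar (G : E × E → ℂ) (μ : κ) (f : E × E → ℂ) (x : E × E) : ℂ :=
  dBar (baseVec b μ) f x -
    ∑ l, (starRingEnd ℂ) (connCoeff b G l μ x) * dBar (fibreVec b l) f x

/-- The expression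
`-(2 / G²) ∑_{γ,α,μ} (∂G/∂v^γ) δ_{μ̄}(Γ^γ_{;α}) v^α conj(v^μ)` at `x = (z, v)`. -/
def coordCurv (G : E × E → ℂ) (x : E × E) : ℂ :=
  -(2 / G x ^ 2) * ∑ γ, ∑ α, ∑ μ, dHol (fibreVec b γ) G x *
    deltaBar b G μ (connCoeff b G γ α) x * b.repr x.2 α * (starRingEnd ℂ) (b.repr x.2 μ)

end Coordinates

/-! ### Metrics on complex manifolds -/

section Manifolds

variable {E : Type*} [NormedAddCommGroup E] [NormedSpace ℂ E] {H : Type*} [TopologicalSpace H]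
  (I : ModelWithCorners ℂ E H) {M : Type*} [TopologicalSpace M] [ChartedSpace H M]
  [IsManifold I 1 M]

/-- The expression of a function on the holomorphic tangent bundle in the holomorphic coordinates
`(z, v)` of the bundle that are induced by the chart of `M` at the base point of `v₀`. -/
def inChart (f : TangentBundle I M → ℝ) (v₀ : TangentBundle I M) (x : E × E) : ℝ :=
  f ((extChartAt I.tangent v₀).symm x)

/-- The holomorphic sectional curvature of a complex Finsler metric `F` along the nonzero tangent
vector `v`, computed from `G = F²` in the holomorphic coordinates that `b` and the chart at the
base point of `v` give. It is a real number that does not depend on the coordinates. -/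
def holSecCurv {κ : Type*} [Fintype κ] [DecidableEq κ] (b : Module.Basis κ ℂ E)
    (F : TangentBundle I M → ℝ) (v : TangentBundle I M) : ℝ :=
  (coordCurv b (fun x => ((inChart I F v x ^ 2 : ℝ) : ℂ)) (extChartAt I.tangent v v)).re

variable (M) in
/-- A `C^∞` Hermitian metric on a complex manifold: a positive definite Hermitian form on each
holomorphic tangent space such that `(z, v) ↦ Q(z, v)` is `C^∞` (in the real sense) in the charts
of the holomorphic tangent bundle, which says that the coefficients of the form are `C^∞`. -/
structure HermitianMetric where
  /-- the Hermitian form, linear in the second and conjugate-linear in the first variable -/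
  form : ∀ p : M, TangentSpace I p →ₗ⋆[ℂ] TangentSpace I p →ₗ[ℂ] ℂ
  conj_symm : ∀ p v w, (starRingEnd ℂ) (form p v w) = form p w v
  pos : ∀ p v, v ≠ 0 → 0 < (form p v v).re
  smooth : ∀ v₀ : TangentBundle I M,
    ContDiffOn ℝ ∞ (inChart I (fun v => (form v.1 v.2 v.2).re) v₀) (extChartAt I.tangent v₀).target

variable {I}

/-- The quadratic function `Q(z, v) = ∑ Q_{αβ̄}(z) v^α conj(v^β)` of a Hermitian metric. -/
def HermitianMetric.quad (Q : HermitianMetric I M) (v : TangentBundle I M) : ℝ :=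
  (Q.form v.1 v.2 v.2).re

/-- The complex Finsler metric `√Q` of a Hermitian metric `Q`. -/
def HermitianMetric.finsler (Q : HermitianMetric I M) (v : TangentBundle I M) : ℝ :=
  Real.sqrt (Q.quad v)

end Manifolds

/-! ### The metrics `F_{t,k}` on a product -/

section Product

variable {n : ℕ} {m : Fin n → ℕ} {M : Fin n → Type*} [∀ l, TopologicalSpace (M l)]
  [∀ l, ChartedSpace (Fin (m l) → ℂ) (M l)]

/-- The model of the product of complex manifolds of dimensions `m 0, …, m (n - 1)`. -/
abbrev prodModel (m : Fin n → ℕ) :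
    ModelWithCorners ℂ (∀ l, Fin (m l) → ℂ) (ModelPi fun l => Fin (m l) → ℂ) :=
  ModelWithCorners.pi fun l => 𝓘(ℂ, Fin (m l) → ℂ)

/-- The coordinate basis of a factor. -/
abbrev factorBasis (d : ℕ) : Module.Basis (Fin d) ℂ (Fin d → ℂ) := Pi.basisFun ℂ (Fin d)

/-- The coordinate basis of the product: the coordinates of all the factors, taken together. -/
abbrev prodBasis (m : Fin n → ℕ) :
    Module.Basis (Σ l, Fin (m l)) ℂ (∀ l, Fin (m l) → ℂ) :=
  Pi.basis fun l => factorBasis (m l)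

variable (m M) in
/-- `(z, v) ↦ (π_l(z), (π_l)_*(v))`, for the projection `π_l` of the product on its factor `l`. -/
def projTangent (l : Fin n) (v : TangentBundle (prodModel m) (∀ l, M l)) :
    TangentBundle 𝓘(ℂ, Fin (m l) → ℂ) (M l) :=
  tangentMap (prodModel m) 𝓘(ℂ, Fin (m l) → ℂ) (fun z : ∀ l, M l => z l) v

variable [∀ l, IsManifold 𝓘(ℂ, Fin (m l) → ℂ) ω (M l)]

/-- `F_{t,k}(z,v) = (1+t)^{-1/2} ( ∑_l Q_l + t (∑_l Q_l^k)^{1/k} )^{1/2}`, where `Q_l` is taken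
at `(π_l(z), (π_l)_*(v))`. -/
def prodFinsler (Q : ∀ l, HermitianMetric 𝓘(ℂ, Fin (m l) → ℂ) (M l)) (t : ℝ) (k : ℕ)
    (v : TangentBundle (prodModel m) (∀ l, M l)) : ℝ :=
  1 / Real.sqrt (1 + t) *
    Real.sqrt (∑ l, (Q l).quad (projTangent m M l v) +
      t * (∑ l, (Q l).quad (projTangent m M l v) ^ k) ^ (1 / (k : ℝ)))

end Product

end ComplexFinsler

end

open ComplexFinsler

/-! ### Charts of the tangent bundle -/

section
variable {𝕜 : Type*} [NontriviallyNormedField 𝕜] {E : Type*} [NormedAddCommGroup E] [NormedSpace 𝕜 E] {H : Type*} [TopologicalSpace H]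
  {I : ModelWithCorners 𝕜 E H} {M : Type*} [TopologicalSpace M] [ChartedSpace H M]
  [IsManifold I 1 M]

/-! In a chart every metric considered has `G = F(r_1, …, r_n)`, where `r_l` is the quadratic
function of the `l`-th factor and `F` has positive partial derivatives `F_l` and positive
semidefinite Hessian on the punctured orthant. The curvature is computed for all such `F`
(`IsConvexIncreasing`); the particular mean enters only at the end.

The Chern-Finsler connection of `G` does not depend on `F`: it is the direct sum of the connections
of the factors (`connCoeff_composite`). Its coefficients are the unique solution of a linear system
whose matrix is the Levi matrix of `G`. That matrix is invertible, since its Hermitian form at `w`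
is `∑ F_l r_l(w_l)` plus the Hessian of `F` at the numbers `∂r_l(w_l)`. The direct sum solves the
system: the terms in `F_l` reproduce the systems of the factors, and the terms in the second
derivatives of `F` match because each `r_l` has zero horizontal derivative
(`sum_dHol_mul_connCoeff`).

The coefficients for a Hermitian metric are linear in `v`, so their horizontal `(0,1)`-derivatives
are plain base derivatives, and the curvature numerator of `G` is the sum of those of the factors
with weights `F_l` (`curvSum_composite`). If the factors have constant curvature `c`, this gives `K
= c (∑ F_l y_l²) / F²` with `y_l = Q_l` (`coordCurv_composite_re`).

The rest concerns nonnegative numbers `y_l`. By homogeneity `F = ∑ F_l y_l`. Each `y_l` is at most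
both `∑ y_j` and the `k`-norm of `y`, so the ratio is at most `1` (`curvRatio_le_one`).
Cauchy-Schwarz with weights `F_l` bounds it below by `1 / ∑ F_l`, and Hölder bounds `∑ F_l` by `(n +
t n^{1/k}) / (1 + t)` (`le_curvRatio`). The limits are read off the explicit rational function of
`t` in `curvRatio_eq`. -/

theorem extChartAt_tangent_symm_apply (v₀ : TangentBundle I M) (z w : E) :
    (extChartAt I.tangent v₀).symm (z, w) =
      ⟨(extChartAt I v₀.1).symm z,
        tangentCoordChange I v₀.1 ((extChartAt I v₀.1).symm z) ((extChartAt I v₀.1).symm z) w⟩ := by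
  rw [show I.tangent = I.prod 𝓘(𝕜, E) from rfl, FiberBundle.extChartAt]
  rfl

theorem extChartAt_tangent_target (v₀ : TangentBundle I M) :
    (extChartAt I.tangent v₀).target = (extChartAt I v₀.1).target ×ˢ Set.univ := by
  rw [show I.tangent = I.prod 𝓘(𝕜, E) from rfl, FiberBundle.extChartAt_target]
  congr 1
  rw [Set.inter_eq_left]
  intro z hz
  have := (extChartAt I v₀.1).map_target hz
  rw [extChartAt_source] at this
  exact this

theorem extChartAt_tangent_self (v : TangentBundle I M) :
    extChartAt I.tangent v v = (extChartAt I v.1 v.1, v.2) := by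
  rw [show I.tangent = I.prod 𝓘(𝕜, E) from rfl, FiberBundle.extChartAt]
  refine Prod.ext rfl ?_
  exact tangentCoordChange_self (mem_extChartAt_source v.1)

end
-- Charts of a product and the projections to the factors
section
variable {n : ℕ} {m : Fin n → ℕ} {M : Fin n → Type*} [∀ l, TopologicalSpace (M l)]
  [∀ l, ChartedSpace (Fin (m l) → ℂ) (M l)]

theorem mem_extChartAt_prodModel_target (p : ∀ l, M l) (z : ∀ l, Fin (m l) → ℂ) :
  z ∈ (extChartAt (prodModel m) p).target ↔ ∀ l, z l ∈ (extChartAt 𝓘(ℂ, Fin (m l) → ℂ) (p l)).target := by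
  simp [extChartAt, piChartedSpace_chartAt, ModelWithCorners.pi, mfld_simps]
  exact Set.mem_univ_pi

theorem mem_extChartAt_prodModel_source (p z : ∀ l, M l) :
  z ∈ (extChartAt (prodModel m) p).source ↔ ∀ l, z l ∈ (extChartAt 𝓘(ℂ, Fin (m l) → ℂ) (p l)).source := by
  simp [extChartAt, piChartedSpace_chartAt, ModelWithCorners.pi, mfld_simps, Set.mem_pi]

theorem range_prodModel : Set.range (prodModel m) = Set.univ := by
  rw [Set.eq_univ_iff_forall]
  exact fun x => ⟨x, rfl⟩

/-- In the product chart the projection to a factor is the linear coordinate projection, which is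
therefore its own derivative. -/
theorem projTangent_eq (l : Fin n) (v : TangentBundle (prodModel m) (∀ l, M l)) :
    projTangent m M l v = ⟨v.1 l, v.2 l⟩ := by
  have key : HasMFDerivAt (prodModel m) 𝓘(ℂ, Fin (m l) → ℂ) (fun z : ∀ l, M l => z l) v.1
      (ContinuousLinearMap.proj (R := ℂ) (φ := fun l => Fin (m l) → ℂ) l) := by
    refine ⟨(continuous_apply l).continuousAt, ?_⟩
    refine HasFDerivAt.hasFDerivWithinAt ?_
    refine (ContinuousLinearMap.proj (R := ℂ) (φ := fun l => Fin (m l) → ℂ) l).hasFDerivAt.congr_of_eventuallyEq ?_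
    have : (extChartAt (prodModel m) v.1).target ∈ 𝓝 (extChartAt (prodModel m) v.1 v.1) := by
      simpa [range_prodModel] using extChartAt_target_mem_nhdsWithin (I := prodModel m) v.1
    filter_upwards [this] with z hz
    exact (extChartAt 𝓘(ℂ, Fin (m l) → ℂ) (v.1 l)).right_inv ((mem_extChartAt_prodModel_target _ _).1 hz l)
  show (⟨_, mfderiv (prodModel m) 𝓘(ℂ, Fin (m l) → ℂ) (fun z : ∀ l, M l => z l) v.1 v.2⟩ : TangentBundle 𝓘(ℂ, Fin (m l) → ℂ) (M l)) = _
  rw [key.mfderiv]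
  rfl

variable [∀ l, IsManifold 𝓘(ℂ, Fin (m l) → ℂ) ω (M l)]

/-- Transition maps of product charts act factor by factor, so both sides are derivatives of the
same function and derivatives are unique. -/
theorem tangentCoordChange_prodModel_apply (p q z : ∀ l, M l) (hz : z ∈ (extChartAt (prodModel m) p).source)
   (hz' : z ∈ (extChartAt (prodModel m) q).source) (w : ∀ l, Fin (m l) → ℂ) (l : Fin n) :
   tangentCoordChange (prodModel m) p q z w l = tangentCoordChange 𝓘(ℂ, Fin (m l) → ℂ) (p l) (q l) (z l) (w l) := by
  have h := hasFDerivWithinAt_tangentCoordChange (I := prodModel m) ⟨hz, hz'⟩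
  rw [range_prodModel, hasFDerivWithinAt_univ, hasFDerivAt_pi'] at h
  have h2 := hasFDerivWithinAt_tangentCoordChange (I := 𝓘(ℂ, Fin (m l) → ℂ)) 
    ⟨(mem_extChartAt_prodModel_source _ _).1 hz l, (mem_extChartAt_prodModel_source _ _).1 hz' l⟩
  rw [ModelWithCorners.range_eq_univ, hasFDerivWithinAt_univ] at h2
  have h3 := h2.comp (f := fun x : ∀ l, Fin (m l) → ℂ => x l) (extChartAt (prodModel m) p z) (ContinuousLinearMap.proj (R := ℂ) (φ := fun l => Fin (m l) → ℂ) l).hasFDerivAt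
  exact congrArg (fun T : (∀ l, Fin (m l) → ℂ) →L[ℂ] _ => T w) ((h l).unique h3)

/-- This makes `Q_l` on the product, read in a chart, a function of the `l`-th block of coordinates
alone. -/
theorem projTangent_extChartAt_symm (l : Fin n) (v : TangentBundle (prodModel m) (∀ l, M l))
   {z : ∀ l, Fin (m l) → ℂ} (hz : z ∈ (extChartAt (prodModel m) v.1).target) (w : ∀ l, Fin (m l) → ℂ) :
   projTangent m M l ((extChartAt (prodModel m).tangent v).symm (z, w)) = 
    (extChartAt (𝓘(ℂ, Fin (m l) → ℂ)).tangent (projTangent m M l v)).symm (z l, w l) := by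
  rw [extChartAt_tangent_symm_apply v, projTangent_eq, projTangent_eq,
    extChartAt_tangent_symm_apply]
  exact congrArg (Bundle.TotalSpace.mk _) (tangentCoordChange_prodModel_apply _ _ _
    ((extChartAt (prodModel m) v.1).map_target hz) (mem_extChartAt_source _) w l)

end

/-! ### Calculus of Wirtinger derivatives -/

section Wirtinger

variable {V W : Type*} [NormedAddCommGroup V] [NormedSpace ℂ V]
  [NormedAddCommGroup W] [NormedSpace ℂ W]

theorem dHol_congr {f g : V → ℂ} {x : V} (h : f =ᶠ[𝓝 x] g) (w : V) :
    dHol w f x = dHol w g x := by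
  simp only [dHol, h.fderiv_eq]

theorem dBar_congr {f g : V → ℂ} {x : V} (h : f =ᶠ[𝓝 x] g) (w : V) :
    dBar w f x = dBar w g x := by
  simp only [dBar, h.fderiv_eq]

theorem dBar_zero_right (w x : V) : dBar w (fun _ => (0 : ℂ)) x = 0 := by simp [dBar]

theorem dHol_zero_left (f : V → ℂ) (x : V) : dHol 0 f x = 0 := by simp [dHol]

theorem dBar_zero_left (f : V → ℂ) (x : V) : dBar 0 f x = 0 := by simp [dBar]

theorem dHol_mul {f g : V → ℂ} {x : V} (hf : DifferentiableAt ℝ f x)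
    (hg : DifferentiableAt ℝ g x) (w : V) :
    dHol w (fun y => f y * g y) x = f x * dHol w g x + dHol w f x * g x := by
  simp only [dHol, fderiv_fun_mul hf hg]
  simp
  ring

theorem dBar_mul {f g : V → ℂ} {x : V} (hf : DifferentiableAt ℝ f x)
    (hg : DifferentiableAt ℝ g x) (w : V) :
    dBar w (fun y => f y * g y) x = f x * dBar w g x + dBar w f x * g x := by
  simp only [dBar, fderiv_fun_mul hf hg]
  simp
  ring

theorem dHol_sum {ι : Type*} {s : Finset ι} {f : ι → V → ℂ} {x : V}
    (hf : ∀ i ∈ s, DifferentiableAt ℝ (f i) x) (w : V) :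
    dHol w (fun y => ∑ i ∈ s, f i y) x = ∑ i ∈ s, dHol w (f i) x := by
  simp only [dHol, fderiv_fun_sum hf]
  simp [Finset.mul_sum, ← Finset.sum_sub_distrib, Finset.sum_div]

theorem dBar_sum {ι : Type*} {s : Finset ι} {f : ι → V → ℂ} {x : V}
    (hf : ∀ i ∈ s, DifferentiableAt ℝ (f i) x) (w : V) :
    dBar w (fun y => ∑ i ∈ s, f i y) x = ∑ i ∈ s, dBar w (f i) x := by
  simp only [dBar, fderiv_fun_sum hf]
  simp [Finset.mul_sum, ← Finset.sum_add_distrib, Finset.sum_div]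

theorem fderiv_comp_clm {f : W → ℂ} (L : V →L[ℂ] W) {x : V}
    (hf : DifferentiableAt ℝ f (L x)) (w : V) :
    fderiv ℝ (fun y => f (L y)) x w = fderiv ℝ f (L x) (L w) := by
  have h := hf.hasFDerivAt.comp x (L.restrictScalars ℝ).hasFDerivAt
  exact congrArg (fun T : V →L[ℝ] ℂ => T w) h.fderiv

/-- Complex linearity of `L` is what is needed: it commutes with multiplication by `i`, so types are
preserved. -/
theorem dHol_comp_clm {f : W → ℂ} (L : V →L[ℂ] W) {x : V}
    (hf : DifferentiableAt ℝ f (L x)) (w : V) :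
    dHol w (fun y => f (L y)) x = dHol (L w) f (L x) := by
  simp only [dHol, fderiv_comp_clm L hf, map_smul]

theorem dBar_comp_clm {f : W → ℂ} (L : V →L[ℂ] W) {x : V}
    (hf : DifferentiableAt ℝ f (L x)) (w : V) :
    dBar w (fun y => f (L y)) x = dBar (L w) f (L x) := by
  simp only [dBar, fderiv_comp_clm L hf, map_smul]

theorem fderiv_clm (L : V →L[ℂ] ℂ) (x w : V) : fderiv ℝ (fun y => L y) x w = L w :=
  congrArg (fun T : V →L[ℝ] ℂ => T w) (L.restrictScalars ℝ).hasFDerivAt.fderiv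

theorem fderiv_conj_clm (L : V →L[ℂ] ℂ) (x w : V) :
    fderiv ℝ (fun y => (starRingEnd ℂ) (L y)) x w = (starRingEnd ℂ) (L w) :=
  congrArg (fun T : V →L[ℝ] ℂ => T w)
    ((Complex.conjCLE : ℂ →L[ℝ] ℂ).hasFDerivAt.comp x (L.restrictScalars ℝ).hasFDerivAt).fderiv

theorem dHol_clm (L : V →L[ℂ] ℂ) (x w : V) : dHol w (fun y => L y) x = L w := by
  simp only [dHol, fderiv_clm, map_smul, smul_eq_mul]
  linear_combination (-L w / 2) * Complex.I_mul_I

theorem dBar_clm (L : V →L[ℂ] ℂ) (x w : V) : dBar w (fun y => L y) x = 0 := by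
  simp only [dBar, fderiv_clm, map_smul, smul_eq_mul]
  linear_combination (L w / 2) * Complex.I_mul_I

theorem dHol_conj_clm (L : V →L[ℂ] ℂ) (x w : V) :
    dHol w (fun y => (starRingEnd ℂ) (L y)) x = 0 := by
  simp only [dHol, fderiv_conj_clm, map_smul, smul_eq_mul, map_mul, Complex.conj_I]
  linear_combination ((starRingEnd ℂ) (L w) / 2) * Complex.I_mul_I

theorem dBar_conj_clm (L : V →L[ℂ] ℂ) (x w : V) :
    dBar w (fun y => (starRingEnd ℂ) (L y)) x = (starRingEnd ℂ) (L w) := by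
  simp only [dBar, fderiv_conj_clm, map_smul, smul_eq_mul, map_mul, Complex.conj_I]
  linear_combination (-(starRingEnd ℂ) (L w) / 2) * Complex.I_mul_I

theorem contDiffOn_dHol {f : V → ℂ} {U : Set V} (hU : IsOpen U) (hf : ContDiffOn ℝ ∞ f U)
    (w : V) : ContDiffOn ℝ ∞ (dHol w f) U := by
  have h : ContDiffOn ℝ ∞ (fderiv ℝ f) U := hf.fderiv_of_isOpen hU (by simp)
  unfold dHol
  fun_prop

theorem contDiffOn_dBar {f : V → ℂ} {U : Set V} (hU : IsOpen U) (hf : ContDiffOn ℝ ∞ f U)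
    (w : V) : ContDiffOn ℝ ∞ (dBar w f) U := by
  have h : ContDiffOn ℝ ∞ (fderiv ℝ f) U := hf.fderiv_of_isOpen hU (by simp)
  unfold dBar
  fun_prop

theorem ContDiffOn.differentiableAt_of_isOpen {f : V → ℂ} {U : Set V} (hU : IsOpen U)
    (hf : ContDiffOn ℝ ∞ f U) {x : V} (hx : x ∈ U) : DifferentiableAt ℝ f x :=
  (hf.contDiffAt (hU.mem_nhds hx)).differentiableAt (by simp)

end Wirtinger

/-! ### Smoothness of the inverse matrix -/

section MatrixInverse

theorem contDiffOn_det {V κ : Type*} [NormedAddCommGroup V] [NormedSpace ℝ V] [Fintype κ]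
    [DecidableEq κ] {A : V → Matrix κ κ ℂ} {U : Set V}
    (hA : ∀ i j, ContDiffOn ℝ ∞ (fun z => A z i j) U) :
    ContDiffOn ℝ ∞ (fun z => (A z).det) U := by
  simp only [Matrix.det_apply']
  exact ContDiffOn.sum fun σ _ => contDiffOn_const.mul (contDiffOn_prod fun i _ => hA _ _)

/-- Cramer's rule: the adjugate entries are determinants of matrices with one row replaced by a
constant one. -/
theorem contDiffOn_matrix_inv {V κ : Type*} [NormedAddCommGroup V] [NormedSpace ℝ V] [Fintype κ]
    [DecidableEq κ] {A : V → Matrix κ κ ℂ} {U : Set V}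
    (hA : ∀ i j, ContDiffOn ℝ ∞ (fun z => A z i j) U) (hu : ∀ z ∈ U, (A z).det ≠ 0) (i j : κ) :
    ContDiffOn ℝ ∞ (fun z => (A z)⁻¹ i j) U := by
  simp only [Matrix.inv_def, Ring.inverse_eq_inv', Matrix.smul_apply, smul_eq_mul,
    Matrix.adjugate_apply]
  refine ((contDiffOn_det hA).inv hu).mul (contDiffOn_det fun a b => ?_)
  by_cases h : a = j
  · subst h
    simpa using contDiffOn_const
  · simpa [Matrix.updateRow_apply, h] using hA a b

end MatrixInverse

/-! ### Hermitian quadratic functions in coordinates and their connection -/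

/-- `h` is the coefficient matrix, smooth on the open set `U`, of the positive definite Hermitian
quadratic function `r`. -/
structure IsHermitianCoeff {κ : Type*} [Fintype κ] (U : Set (κ → ℂ))
    (h : (κ → ℂ) → Matrix κ κ ℂ) (r : (κ → ℂ) × (κ → ℂ) → ℝ) : Prop where
  isOpen : IsOpen U
  smooth : ∀ a b, ContDiffOn ℝ ∞ (fun z => h z a b) U
  conj : ∀ z a b, (starRingEnd ℂ) (h z a b) = h z b a
  eq : ∀ z ∈ U, ∀ w, (r (z, w) : ℂ) = ∑ a, ∑ b, h z a b * w a * (starRingEnd ℂ) (w b)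
  pos : ∀ z ∈ U, ∀ w, w ≠ 0 → 0 < r (z, w)

section Atoms

variable {κ : Type*} [Fintype κ]

theorem differentiable_snd_coord (a : κ) :
    Differentiable ℝ (fun x : (κ → ℂ) × (κ → ℂ) => x.2 a) := by fun_prop

theorem differentiable_conj_snd_coord (a : κ) :
    Differentiable ℝ (fun x : (κ → ℂ) × (κ → ℂ) => (starRingEnd ℂ) (x.2 a)) :=
  (Complex.conjCLE : ℂ →L[ℝ] ℂ).differentiable.comp (differentiable_snd_coord a)

theorem contDiff_conj_snd_coord (a : κ) :
    ContDiff ℝ ∞ (fun x : (κ → ℂ) × (κ → ℂ) => (starRingEnd ℂ) (x.2 a)) :=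
  (Complex.conjCLE : ℂ →L[ℝ] ℂ).contDiff.comp (by fun_prop)

theorem dHol_snd_coord (a : κ) (x w : (κ → ℂ) × (κ → ℂ)) :
    dHol w (fun x : (κ → ℂ) × (κ → ℂ) => x.2 a) x = w.2 a :=
  dHol_clm ((ContinuousLinearMap.proj a).comp (ContinuousLinearMap.snd ℂ (κ → ℂ) (κ → ℂ))) x w

theorem dBar_snd_coord (a : κ) (x w : (κ → ℂ) × (κ → ℂ)) :
    dBar w (fun x : (κ → ℂ) × (κ → ℂ) => x.2 a) x = 0 :=
  dBar_clm ((ContinuousLinearMap.proj a).comp (ContinuousLinearMap.snd ℂ (κ → ℂ) (κ → ℂ))) x w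

theorem dHol_conj_snd_coord (a : κ) (x w : (κ → ℂ) × (κ → ℂ)) :
    dHol w (fun x : (κ → ℂ) × (κ → ℂ) => (starRingEnd ℂ) (x.2 a)) x = 0 :=
  dHol_conj_clm ((ContinuousLinearMap.proj a).comp (ContinuousLinearMap.snd ℂ (κ → ℂ) (κ → ℂ))) x w

theorem dBar_conj_snd_coord (a : κ) (x w : (κ → ℂ) × (κ → ℂ)) :
    dBar w (fun x : (κ → ℂ) × (κ → ℂ) => (starRingEnd ℂ) (x.2 a)) x = (starRingEnd ℂ) (w.2 a) :=
  dBar_conj_clm ((ContinuousLinearMap.proj a).comp (ContinuousLinearMap.snd ℂ (κ → ℂ) (κ → ℂ))) x w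

theorem dHol_comp_fst {f : (κ → ℂ) → ℂ} {x : (κ → ℂ) × (κ → ℂ)}
    (hf : DifferentiableAt ℝ f x.1) (w : (κ → ℂ) × (κ → ℂ)) :
    dHol w (fun x : (κ → ℂ) × (κ → ℂ) => f x.1) x = dHol w.1 f x.1 :=
  dHol_comp_clm (ContinuousLinearMap.fst ℂ (κ → ℂ) (κ → ℂ)) hf w

theorem dBar_comp_fst {f : (κ → ℂ) → ℂ} {x : (κ → ℂ) × (κ → ℂ)}
    (hf : DifferentiableAt ℝ f x.1) (w : (κ → ℂ) × (κ → ℂ)) :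
    dBar w (fun x : (κ → ℂ) × (κ → ℂ) => f x.1) x = dBar w.1 f x.1 :=
  dBar_comp_clm (ContinuousLinearMap.fst ℂ (κ → ℂ) (κ → ℂ)) hf w

theorem dHol_mul_snd_coord {f : (κ → ℂ) → ℂ} {x : (κ → ℂ) × (κ → ℂ)}
    (hf : DifferentiableAt ℝ f x.1) (w : (κ → ℂ) × (κ → ℂ)) (a : κ) :
    dHol w (fun x : (κ → ℂ) × (κ → ℂ) => f x.1 * x.2 a) x =
      f x.1 * w.2 a + dHol w.1 f x.1 * x.2 a := by
  rw [dHol_mul (by fun_prop) (by fun_prop), dHol_comp_fst hf, dHol_snd_coord]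

theorem dBar_mul_snd_coord {f : (κ → ℂ) → ℂ} {x : (κ → ℂ) × (κ → ℂ)}
    (hf : DifferentiableAt ℝ f x.1) (w : (κ → ℂ) × (κ → ℂ)) (a : κ) :
    dBar w (fun x : (κ → ℂ) × (κ → ℂ) => f x.1 * x.2 a) x = dBar w.1 f x.1 * x.2 a := by
  rw [dBar_mul (by fun_prop) (by fun_prop), dBar_comp_fst hf, dBar_snd_coord]
  ring

theorem dHol_hermitian_term {f : (κ → ℂ) → ℂ} {x : (κ → ℂ) × (κ → ℂ)}
    (hf : DifferentiableAt ℝ f x.1) (w : (κ → ℂ) × (κ → ℂ)) (a b : κ) :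
    dHol w (fun x : (κ → ℂ) × (κ → ℂ) => f x.1 * x.2 a * (starRingEnd ℂ) (x.2 b)) x =
      (f x.1 * w.2 a + dHol w.1 f x.1 * x.2 a) * (starRingEnd ℂ) (x.2 b) := by
  rw [dHol_mul (by fun_prop) (differentiable_conj_snd_coord b x), dHol_mul_snd_coord hf,
    dHol_conj_snd_coord]
  ring

theorem dBar_hermitian_term {f : (κ → ℂ) → ℂ} {x : (κ → ℂ) × (κ → ℂ)}
    (hf : DifferentiableAt ℝ f x.1) (w : (κ → ℂ) × (κ → ℂ)) (a b : κ) :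
    dBar w (fun x : (κ → ℂ) × (κ → ℂ) => f x.1 * x.2 a * (starRingEnd ℂ) (x.2 b)) x =
      f x.1 * x.2 a * (starRingEnd ℂ) (w.2 b) +
        dBar w.1 f x.1 * x.2 a * (starRingEnd ℂ) (x.2 b) := by
  rw [dBar_mul (by fun_prop) (differentiable_conj_snd_coord b x), dBar_mul_snd_coord hf,
    dBar_conj_snd_coord]

theorem differentiableAt_mul_snd_coord {f : (κ → ℂ) → ℂ} {x : (κ → ℂ) × (κ → ℂ)}
    (hf : DifferentiableAt ℝ f x.1) (a : κ) :
    DifferentiableAt ℝ (fun x : (κ → ℂ) × (κ → ℂ) => f x.1 * x.2 a) x := by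
  fun_prop

theorem differentiableAt_hermitian_term {f : (κ → ℂ) → ℂ} {x : (κ → ℂ) × (κ → ℂ)}
    (hf : DifferentiableAt ℝ f x.1) (a b : κ) :
    DifferentiableAt ℝ
      (fun x : (κ → ℂ) × (κ → ℂ) => f x.1 * x.2 a * (starRingEnd ℂ) (x.2 b)) x :=
  DifferentiableAt.mul (by fun_prop) (differentiable_conj_snd_coord b x)

end Atoms

namespace IsHermitianCoeff

variable {κ : Type*} [Fintype κ] {U : Set (κ → ℂ)} {h : (κ → ℂ) → Matrix κ κ ℂ}
  {r : (κ → ℂ) × (κ → ℂ) → ℝ} (H : IsHermitianCoeff U h r)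
include H

theorem isOpen_prod : IsOpen (U ×ˢ (Set.univ : Set (κ → ℂ))) := H.isOpen.prod isOpen_univ

theorem mem_nhds {x : (κ → ℂ) × (κ → ℂ)} (hx : x.1 ∈ U) : U ×ˢ (Set.univ : Set (κ → ℂ)) ∈ 𝓝 x :=
  H.isOpen_prod.mem_nhds ⟨hx, trivial⟩

theorem differentiableAt {z : κ → ℂ} (hz : z ∈ U) (a b : κ) :
    DifferentiableAt ℝ (fun z => h z a b) z :=
  ContDiffOn.differentiableAt_of_isOpen H.isOpen (H.smooth a b) hz

theorem nonneg {z : κ → ℂ} (hz : z ∈ U) (w : κ → ℂ) : 0 ≤ r (z, w) := by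
  by_cases hw : w = 0
  · have := H.eq z hz w
    simp only [hw, Pi.zero_apply, mul_zero, map_zero, Finset.sum_const_zero] at this ⊢
    rw [Complex.ofReal_eq_zero.1 this]
  · exact (H.pos z hz w hw).le

theorem eqOn : Set.EqOn (fun x => (r x : ℂ))
    (fun x => ∑ a, ∑ b, h x.1 a b * x.2 a * (starRingEnd ℂ) (x.2 b)) (U ×ˢ Set.univ) :=
  fun x hx => H.eq x.1 hx.1 x.2

theorem contDiffOn : ContDiffOn ℝ ∞ (fun x => (r x : ℂ)) (U ×ˢ Set.univ) := by
  refine ContDiffOn.congr ?_ H.eqOn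
  refine ContDiffOn.sum fun a _ => ContDiffOn.sum fun b _ => ?_
  refine ContDiffOn.mul (ContDiffOn.mul ?_ (by fun_prop)) (contDiff_conj_snd_coord b).contDiffOn
  exact (H.smooth a b).comp contDiffOn_fst fun x hx => hx.1

theorem dHol_eq {x : (κ → ℂ) × (κ → ℂ)} (hx : x.1 ∈ U) (w : (κ → ℂ) × (κ → ℂ)) :
    dHol w (fun x => (r x : ℂ)) x = ∑ a, ∑ b,
      (h x.1 a b * w.2 a + dHol w.1 (fun z => h z a b) x.1 * x.2 a) * (starRingEnd ℂ) (x.2 b) := by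
  have hd := fun a b => differentiableAt_hermitian_term (H.differentiableAt hx a b) a b
  rw [dHol_congr (H.eqOn.eventuallyEq_of_mem (H.mem_nhds hx)),
    dHol_sum fun a _ => DifferentiableAt.fun_sum fun b _ => hd a b]
  refine Finset.sum_congr rfl fun a _ => ?_
  rw [dHol_sum fun b _ => hd a b]
  exact Finset.sum_congr rfl fun b _ => dHol_hermitian_term (H.differentiableAt hx a b) w a b

theorem dBar_eq {x : (κ → ℂ) × (κ → ℂ)} (hx : x.1 ∈ U) (w : (κ → ℂ) × (κ → ℂ)) :
    dBar w (fun x => (r x : ℂ)) x = ∑ a, ∑ b, (h x.1 a b * x.2 a * (starRingEnd ℂ) (w.2 b) +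
      dBar w.1 (fun z => h z a b) x.1 * x.2 a * (starRingEnd ℂ) (x.2 b)) := by
  have hd := fun a b => differentiableAt_hermitian_term (H.differentiableAt hx a b) a b
  rw [dBar_congr (H.eqOn.eventuallyEq_of_mem (H.mem_nhds hx)),
    dBar_sum fun a _ => DifferentiableAt.fun_sum fun b _ => hd a b]
  refine Finset.sum_congr rfl fun a _ => ?_
  rw [dBar_sum fun b _ => hd a b]
  exact Finset.sum_congr rfl fun b _ => dBar_hermitian_term (H.differentiableAt hx a b) w a b

variable [DecidableEq κ]

local notation "bas" => Pi.basisFun ℂ κ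

theorem dHol_fibreVec {x : (κ → ℂ) × (κ → ℂ)} (hx : x.1 ∈ U) (a : κ) :
    dHol (fibreVec bas a) (fun x => (r x : ℂ)) x =
      ∑ b, h x.1 a b * (starRingEnd ℂ) (x.2 b) := by
  rw [H.dHol_eq hx]
  simp [fibreVec, dHol_zero_left, Pi.single_apply]

theorem dBar_fibreVec {x : (κ → ℂ) × (κ → ℂ)} (hx : x.1 ∈ U) (b : κ) :
    dBar (fibreVec bas b) (fun x => (r x : ℂ)) x = ∑ a, h x.1 a b * x.2 a := by
  rw [H.dBar_eq hx]
  simp [fibreVec, dBar_zero_left, Pi.single_apply]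

theorem dHol_baseVec {x : (κ → ℂ) × (κ → ℂ)} (hx : x.1 ∈ U) (m : κ) :
    dHol (baseVec bas m) (fun x => (r x : ℂ)) x = ∑ a, ∑ b,
      dHol (Pi.single m 1) (fun z => h z a b) x.1 * x.2 a * (starRingEnd ℂ) (x.2 b) := by
  rw [H.dHol_eq hx]
  simp [baseVec]

theorem leviMatrix_eq {x : (κ → ℂ) × (κ → ℂ)} (hx : x.1 ∈ U) :
    leviMatrix bas (fun x => (r x : ℂ)) x = h x.1 := by
  ext a b
  have he : dBar (fibreVec bas b) (fun x => (r x : ℂ)) =ᶠ[𝓝 x]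
      fun x => ∑ a, h x.1 a b * x.2 a := by
    filter_upwards [H.mem_nhds hx] with y hy using H.dBar_fibreVec hy.1 b
  have hd := fun c => H.differentiableAt hx c b
  simp only [leviMatrix, Matrix.of_apply]
  rw [dHol_congr he, dHol_sum fun c _ => by have := hd c; fun_prop]
  simp only [dHol_mul_snd_coord (hd _)]
  simp [fibreVec, dHol_zero_left, Pi.single_apply]

theorem dBar_dHol {x : (κ → ℂ) × (κ → ℂ)} (hx : x.1 ∈ U) (t m : κ) :
    dBar (fibreVec bas t) (dHol (baseVec bas m) (fun x => (r x : ℂ))) x =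
      ∑ a, dHol (Pi.single m 1) (fun z => h z a t) x.1 * x.2 a := by
  have he : dHol (baseVec bas m) (fun x => (r x : ℂ)) =ᶠ[𝓝 x] fun x => ∑ a, ∑ b,
      dHol (Pi.single m 1) (fun z => h z a b) x.1 * x.2 a * (starRingEnd ℂ) (x.2 b) := by
    filter_upwards [H.mem_nhds hx] with y hy using H.dHol_baseVec hy.1 m
  have hd' : ∀ a b, DifferentiableAt ℝ (dHol (Pi.single m 1) (fun z => h z a b)) x.1 :=
    fun a b => ContDiffOn.differentiableAt_of_isOpen H.isOpen
      (contDiffOn_dHol H.isOpen (H.smooth a b) _) hx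
  have hd := fun a b => differentiableAt_hermitian_term (hd' a b) a b
  rw [dBar_congr he, dBar_sum fun a _ => DifferentiableAt.fun_sum fun b _ => hd a b]
  refine Finset.sum_congr rfl fun a _ => ?_
  rw [dBar_sum fun b _ => hd a b]
  simp only [dBar_hermitian_term (hd' _ _)]
  simp [fibreVec, dBar_zero_left, Pi.single_apply]

/-- A left null vector `w` of the coefficient matrix would give `r (z, w) = 0`, against positivity.
-/
theorem det_ne_zero {z : κ → ℂ} (hz : z ∈ U) : (h z).det ≠ 0 := by
  intro h0
  obtain ⟨w, hw, hw0⟩ := Matrix.exists_vecMul_eq_zero_iff.2 h0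
  have h1 := H.eq z hz w
  rw [Finset.sum_comm] at h1
  have h2 : (r (z, w) : ℂ) = 0 := by
    rw [h1]
    refine Finset.sum_eq_zero fun b _ => ?_
    have := congrFun hw0 b
    simp only [Matrix.vecMul, dotProduct, Pi.zero_apply] at this
    rw [← Finset.sum_mul]
    simp only [mul_comm (h z _ b), this, zero_mul]
  exact (H.pos z hz w hw).ne' (Complex.ofReal_eq_zero.1 h2)

theorem isUnit_det {z : κ → ℂ} (hz : z ∈ U) : IsUnit (h z).det := (H.det_ne_zero hz).isUnit

/-- The connection of a Hermitian metric is linear in the fibre coordinates. -/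
theorem connCoeff_eq {x : (κ → ℂ) × (κ → ℂ)} (hx : x.1 ∈ U) (a m : κ) :
    connCoeff bas (fun x => (r x : ℂ)) a m x = ∑ c, (∑ t, (h x.1)⁻¹ t a *
      dHol (Pi.single m 1) (fun z => h z c t) x.1) * x.2 c := by
  simp only [connCoeff, H.leviMatrix_eq hx, H.dBar_dHol hx, Finset.mul_sum, Finset.sum_mul]
  rw [Finset.sum_comm]
  simp only [mul_assoc]

theorem contDiffOn_connSymbol (a m c : κ) : ContDiffOn ℝ ∞ (fun z => ∑ t, (h z)⁻¹ t a *
    dHol (Pi.single m 1) (fun z => h z c t) z) U :=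
  ContDiffOn.sum fun t _ => (contDiffOn_matrix_inv H.smooth (fun _ hz => H.det_ne_zero hz) t a).mul
    (contDiffOn_dHol H.isOpen (H.smooth c t) _)

theorem connCoeff_eventuallyEq {x : (κ → ℂ) × (κ → ℂ)} (hx : x.1 ∈ U) (a m : κ) :
    connCoeff bas (fun x => (r x : ℂ)) a m =ᶠ[𝓝 x] fun x => ∑ c, (∑ t, (h x.1)⁻¹ t a *
      dHol (Pi.single m 1) (fun z => h z c t) x.1) * x.2 c := by
  filter_upwards [H.mem_nhds hx] with y hy using H.connCoeff_eq hy.1 a m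

theorem differentiableAt_connCoeff {x : (κ → ℂ) × (κ → ℂ)} (hx : x.1 ∈ U) (a m : κ) :
    DifferentiableAt ℝ (connCoeff bas (fun x => (r x : ℂ)) a m) x := by
  refine DifferentiableAt.congr_of_eventuallyEq ?_ (H.connCoeff_eventuallyEq hx a m)
  exact DifferentiableAt.fun_sum fun c _ => differentiableAt_mul_snd_coord
    (ContDiffOn.differentiableAt_of_isOpen H.isOpen (H.contDiffOn_connSymbol a m c) hx) c

/-- The coefficients are linear in `v`, hence holomorphic along the fibre; the vertical part of
`deltaBar` drops out. -/
theorem dBar_fibreVec_connCoeff {x : (κ → ℂ) × (κ → ℂ)} (hx : x.1 ∈ U) (a m l : κ) :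
    dBar (fibreVec bas l) (connCoeff bas (fun x => (r x : ℂ)) a m) x = 0 := by
  have hd := fun c => ContDiffOn.differentiableAt_of_isOpen H.isOpen
    (H.contDiffOn_connSymbol a m c) hx
  rw [dBar_congr (H.connCoeff_eventuallyEq hx a m), 
    dBar_sum fun c _ => differentiableAt_mul_snd_coord (hd c) c]
  refine Finset.sum_eq_zero fun c _ => ?_
  rw [dBar_mul_snd_coord (hd c)]
  simp [fibreVec, dBar_zero_left]

theorem deltaBar_connCoeff {x : (κ → ℂ) × (κ → ℂ)} (hx : x.1 ∈ U) (a m l : κ) :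
    deltaBar bas (fun x => (r x : ℂ)) l (connCoeff bas (fun x => (r x : ℂ)) a m) x =
      dBar (baseVec bas l) (connCoeff bas (fun x => (r x : ℂ)) a m) x := by
  simp [deltaBar, H.dBar_fibreVec_connCoeff hx]

/-- The connection solves its defining linear system. -/
theorem sum_mul_connCoeff {x : (κ → ℂ) × (κ → ℂ)} (hx : x.1 ∈ U) (t m : κ) :
    ∑ a, h x.1 a t * connCoeff bas (fun x => (r x : ℂ)) a m x =
      dBar (fibreVec bas t) (dHol (baseVec bas m) (fun x => (r x : ℂ))) x := by
  have hinv : ∀ s, ∑ a, h x.1 a t * (h x.1)⁻¹ s a = (1 : Matrix κ κ ℂ) s t := fun s => by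
    rw [← Matrix.nonsing_inv_mul _ (H.isUnit_det hx), Matrix.mul_apply]
    exact Finset.sum_congr rfl fun a _ => mul_comm _ _
  simp only [connCoeff, H.leviMatrix_eq hx, Finset.mul_sum, ← mul_assoc]
  rw [Finset.sum_comm]
  simp only [← Finset.sum_mul, hinv]
  simp [Matrix.one_apply]

/-- The horizontal derivative of `r` vanishes. This is the defining system of the connection
contracted with the conjugate of `v`. -/
theorem sum_dHol_mul_connCoeff {x : (κ → ℂ) × (κ → ℂ)} (hx : x.1 ∈ U) (m : κ) :
    ∑ a, dHol (fibreVec bas a) (fun x => (r x : ℂ)) x *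
      connCoeff bas (fun x => (r x : ℂ)) a m x = dHol (baseVec bas m) (fun x => (r x : ℂ)) x := by
  have key : ∀ b, ∑ a, dHol (Pi.single m 1) (fun z => h z a b) x.1 * x.2 a *
      (starRingEnd ℂ) (x.2 b) = ∑ a, h x.1 a b * (starRingEnd ℂ) (x.2 b) *
        connCoeff bas (fun x => (r x : ℂ)) a m x := fun b => by
    rw [← Finset.sum_mul, ← H.dBar_dHol hx, ← H.sum_mul_connCoeff hx, Finset.sum_mul]
    exact Finset.sum_congr rfl fun a _ => by ring
  rw [H.dHol_baseVec hx, Finset.sum_comm]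
  simp only [key, H.dHol_fibreVec hx, Finset.sum_mul]
  rw [Finset.sum_comm]

theorem dBar_fibreVec_eq_conj {x : (κ → ℂ) × (κ → ℂ)} (hx : x.1 ∈ U) (a : κ) :
    dBar (fibreVec bas a) (fun x => (r x : ℂ)) x =
      (starRingEnd ℂ) (dHol (fibreVec bas a) (fun x => (r x : ℂ)) x) := by
  simp [H.dHol_fibreVec hx, H.dBar_fibreVec hx, H.conj]

end IsHermitianCoeff

/-! ### Chain rule for real functions of several real-valued functions -/

section OfRealChain

variable {V : Type*} [NormedAddCommGroup V] [NormedSpace ℂ V] {n : ℕ}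

theorem fderiv_ofReal_comp {φ : (Fin n → ℝ) → ℝ} {c : Fin n → ℝ} {R : Fin n → V → ℝ} {x : V}
    (hφ : HasFDerivAt φ (∑ l, c l • ContinuousLinearMap.proj (R := ℝ) (φ := fun _ => ℝ) l)
      (fun l => R l x))
    (hR : ∀ l, DifferentiableAt ℝ (fun y => (R l y : ℂ)) x) :
    HasFDerivAt (fun y => ((φ fun l => R l y : ℝ) : ℂ))
      (∑ l, (c l : ℂ) • fderiv ℝ (fun y => (R l y : ℂ)) x) x := by
  have hre : ∀ l, HasFDerivAt (R l)
      (Complex.reCLM.comp (fderiv ℝ (fun y => (R l y : ℂ)) x)) x := fun l =>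
    Complex.reCLM.hasFDerivAt.comp x (hR l).hasFDerivAt
  have h1 := Complex.ofRealCLM.hasFDerivAt.comp x
    (hφ.comp (f := fun y l => R l y) x (hasFDerivAt_pi.2 hre))
  refine h1.congr_fderiv ?_
  ext w
  -- Each `R l` is real-valued, so its complex-valued derivative is already real; this lets the real
  -- chain rule be stated with complex derivatives.
  have him : ∀ l, (fderiv ℝ (fun y => (R l y : ℂ)) x) =
      Complex.ofRealCLM.comp (Complex.reCLM.comp (fderiv ℝ (fun y => (R l y : ℂ)) x)) := fun l =>
    (hR l).hasFDerivAt.unique (Complex.ofRealCLM.hasFDerivAt.comp x (hre l))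
  simp only [ContinuousLinearMap.comp_apply, sum_apply,
    smul_apply, map_sum]
  refine Finset.sum_congr rfl fun l _ => ?_
  conv_rhs => rw [him l]
  simp

theorem dHol_ofReal_comp {φ : (Fin n → ℝ) → ℝ} {c : Fin n → ℝ} {R : Fin n → V → ℝ} {x : V}
    (hφ : HasFDerivAt φ (∑ l, c l • ContinuousLinearMap.proj (R := ℝ) (φ := fun _ => ℝ) l)
      (fun l => R l x))
    (hR : ∀ l, DifferentiableAt ℝ (fun y => (R l y : ℂ)) x) (w : V) :
    dHol w (fun y => ((φ fun l => R l y : ℝ) : ℂ)) x =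
      ∑ l, (c l : ℂ) * dHol w (fun y => (R l y : ℂ)) x := by
  simp only [dHol, (fderiv_ofReal_comp hφ hR).fderiv, sum_apply,
    smul_apply, smul_eq_mul, Finset.mul_sum, ← Finset.sum_sub_distrib,
    Finset.sum_div]
  exact Finset.sum_congr rfl fun l _ => by ring

theorem dBar_ofReal_comp {φ : (Fin n → ℝ) → ℝ} {c : Fin n → ℝ} {R : Fin n → V → ℝ} {x : V}
    (hφ : HasFDerivAt φ (∑ l, c l • ContinuousLinearMap.proj (R := ℝ) (φ := fun _ => ℝ) l)
      (fun l => R l x))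
    (hR : ∀ l, DifferentiableAt ℝ (fun y => (R l y : ℂ)) x) (w : V) :
    dBar w (fun y => ((φ fun l => R l y : ℝ) : ℂ)) x =
      ∑ l, (c l : ℂ) * dBar w (fun y => (R l y : ℂ)) x := by
  simp only [dBar, (fderiv_ofReal_comp hφ hR).fderiv, sum_apply,
    smul_apply, smul_eq_mul, Finset.mul_sum, ← Finset.sum_add_distrib,
    Finset.sum_div]
  exact Finset.sum_congr rfl fun l _ => by ring

end OfRealChain

/-- The nonzero vectors with nonnegative coordinates. -/
def puncturedOrthant (n : ℕ) : Set (Fin n → ℝ) := {y | (∀ l, 0 ≤ y l) ∧ ∃ l, 0 < y l}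

/-- A function `F` on the punctured orthant with positive partial derivatives `F₁ l` and positive
semidefinite Hessian `F₂ l j`. -/
structure IsConvexIncreasing {n : ℕ} (F : (Fin n → ℝ) → ℝ) (F₁ : Fin n → (Fin n → ℝ) → ℝ)
    (F₂ : Fin n → Fin n → (Fin n → ℝ) → ℝ) : Prop where
  hasFDerivAt : ∀ y ∈ puncturedOrthant n, HasFDerivAt F
    (∑ l, F₁ l y • ContinuousLinearMap.proj (R := ℝ) (φ := fun _ => ℝ) l) y
  hasFDerivAt_partial : ∀ l, ∀ y ∈ puncturedOrthant n, HasFDerivAt (F₁ l)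
    (∑ j, F₂ l j y • ContinuousLinearMap.proj (R := ℝ) (φ := fun _ => ℝ) j) y
  symm : ∀ l j, ∀ y ∈ puncturedOrthant n, F₂ l j y = F₂ j l y
  pos : ∀ l, ∀ y ∈ puncturedOrthant n, 0 < F₁ l y
  posSemidef : ∀ y ∈ puncturedOrthant n, ∀ A : Fin n → ℂ,
    0 ≤ (∑ l, ∑ j, (F₂ l j y : ℂ) * A j * (starRingEnd ℂ) (A l)).re

/-! ### Functions of the factor metrics: first derivatives and Levi matrix -/

section Product

variable {n : ℕ} {m : Fin n → ℕ}

/-- The projection of coordinates of the tangent bundle of a product on those of a factor. -/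
noncomputable def coordProj (m : Fin n → ℕ) (l : Fin n) :
    ((∀ l, Fin (m l) → ℂ) × (∀ l, Fin (m l) → ℂ)) →L[ℂ] (Fin (m l) → ℂ) × (Fin (m l) → ℂ) :=
  (ContinuousLinearMap.proj (R := ℂ) (φ := fun l => Fin (m l) → ℂ) l).prodMap
    (ContinuousLinearMap.proj (R := ℂ) (φ := fun l => Fin (m l) → ℂ) l)

theorem coordProj_apply (l : Fin n) (x : (∀ l, Fin (m l) → ℂ) × (∀ l, Fin (m l) → ℂ)) :
    coordProj m l x = (x.1 l, x.2 l) := rfl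

theorem prodBasis_apply_same (l : Fin n) (a : Fin (m l)) :
    prodBasis m ⟨l, a⟩ l = factorBasis (m l) a := by
  simp [prodBasis, Pi.basis_apply]

theorem prodBasis_apply_ne {i l : Fin n} (h : l ≠ i) (a : Fin (m i)) :
    prodBasis m ⟨i, a⟩ l = 0 := by
  simp [prodBasis, Pi.basis_apply, h]

theorem coordProj_fibreVec_same (l : Fin n) (a : Fin (m l)) :
    coordProj m l (fibreVec (prodBasis m) ⟨l, a⟩) = fibreVec (factorBasis (m l)) a :=
  Prod.ext rfl (prodBasis_apply_same l a)

theorem coordProj_fibreVec_ne {i l : Fin n} (h : l ≠ i) (a : Fin (m i)) :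
    coordProj m l (fibreVec (prodBasis m) ⟨i, a⟩) = 0 :=
  Prod.ext rfl (prodBasis_apply_ne h a)

theorem coordProj_baseVec_same (l : Fin n) (a : Fin (m l)) :
    coordProj m l (baseVec (prodBasis m) ⟨l, a⟩) = baseVec (factorBasis (m l)) a :=
  Prod.ext (prodBasis_apply_same l a) rfl

theorem coordProj_baseVec_ne {i l : Fin n} (h : l ≠ i) (a : Fin (m i)) :
    coordProj m l (baseVec (prodBasis m) ⟨i, a⟩) = 0 :=
  Prod.ext (prodBasis_apply_ne h a) rfl

theorem prodBasis_repr (v : ∀ l, Fin (m l) → ℂ) (l : Fin n) (a : Fin (m l)) :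
    (prodBasis m).repr v ⟨l, a⟩ = v l a := by
  simp [prodBasis]

variable {U : ∀ l, Set (Fin (m l) → ℂ)}
  {h : ∀ l, (Fin (m l) → ℂ) → Matrix (Fin (m l)) (Fin (m l)) ℂ}
  {r : ∀ l, (Fin (m l) → ℂ) × (Fin (m l) → ℂ) → ℝ}

/-- The coordinates of nonzero tangent vectors with base point in `∏ U l`. -/
def slitDomain (U : ∀ l, Set (Fin (m l) → ℂ)) :
    Set ((∀ l, Fin (m l) → ℂ) × (∀ l, Fin (m l) → ℂ)) :=
  {x | (∀ l, x.1 l ∈ U l) ∧ x.2 ≠ 0}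

theorem isOpen_slitDomain (hU : ∀ l, IsOpen (U l)) : IsOpen (slitDomain U) := by
  have h : slitDomain U = (⋂ l, (Function.eval l ∘ Prod.fst) ⁻¹' U l) ∩ Prod.snd ⁻¹' {v | v ≠ 0} := by
    ext
    simp [slitDomain]
  rw [h]
  refine IsOpen.inter ?_ (isOpen_ne.preimage continuous_snd)
  exact isOpen_iInter_of_finite fun l =>
    (hU l).preimage ((continuous_apply l).comp continuous_fst)

/-- The values of the quadratic functions of the factors. -/
noncomputable def factorValues (r : ∀ l, (Fin (m l) → ℂ) × (Fin (m l) → ℂ) → ℝ)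
    (x : (∀ l, Fin (m l) → ℂ) × (∀ l, Fin (m l) → ℂ)) (l : Fin n) : ℝ := r l (coordProj m l x)

/-- The function `F(r_1, …, r_n)`. -/
noncomputable def composite (F : (Fin n → ℝ) → ℝ) (r : ∀ l, (Fin (m l) → ℂ) × (Fin (m l) → ℂ) → ℝ)
    (x : (∀ l, Fin (m l) → ℂ) × (∀ l, Fin (m l) → ℂ)) : ℂ := (F (factorValues r x) : ℝ)

theorem differentiableAt_comp_coordProj {l : Fin n} {f : (Fin (m l) → ℂ) × (Fin (m l) → ℂ) → ℂ}
    {x : (∀ l, Fin (m l) → ℂ) × (∀ l, Fin (m l) → ℂ)}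
    (hf : DifferentiableAt ℝ f (coordProj m l x)) :
    DifferentiableAt ℝ (fun x => f (coordProj m l x)) x :=
  DifferentiableAt.comp (g := f) x hf ((coordProj m l).restrictScalars ℝ).differentiableAt

variable (H : ∀ l, IsHermitianCoeff (U l) (h l) (r l))
include H

theorem factorValues_mem {x : (∀ l, Fin (m l) → ℂ) × (∀ l, Fin (m l) → ℂ)}
    (hx : x ∈ slitDomain U) : factorValues r x ∈ puncturedOrthant n := by
  refine ⟨fun l => (H l).nonneg (hx.1 l) _, ?_⟩
  obtain ⟨l, hl⟩ := Function.ne_iff.1 hx.2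
  exact ⟨l, (H l).pos _ (hx.1 l) _ hl⟩

theorem slitDomain_mem_nhds {x : (∀ l, Fin (m l) → ℂ) × (∀ l, Fin (m l) → ℂ)}
    (hx : x ∈ slitDomain U) : slitDomain U ∈ 𝓝 x :=
  (isOpen_slitDomain fun l => (H l).isOpen).mem_nhds hx

theorem differentiableAt_factor {x : (∀ l, Fin (m l) → ℂ) × (∀ l, Fin (m l) → ℂ)}
    (hx : x ∈ slitDomain U) (l : Fin n) :
    DifferentiableAt ℝ (fun x => (r l x : ℂ)) (coordProj m l x) :=
  ContDiffOn.differentiableAt_of_isOpen (H l).isOpen_prod (H l).contDiffOn ⟨hx.1 l, trivial⟩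

theorem dHol_comp_factorValues {φ : (Fin n → ℝ) → ℝ} {c : Fin n → ℝ}
    {x : (∀ l, Fin (m l) → ℂ) × (∀ l, Fin (m l) → ℂ)} (hx : x ∈ slitDomain U)
    (hφ : HasFDerivAt φ (∑ l, c l • ContinuousLinearMap.proj (R := ℝ) (φ := fun _ => ℝ) l)
      (factorValues r x)) (w : (∀ l, Fin (m l) → ℂ) × (∀ l, Fin (m l) → ℂ)) :
    dHol w (composite φ r) x =
      ∑ l, (c l : ℂ) * dHol (coordProj m l w) (fun x => (r l x : ℂ)) (coordProj m l x) := by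
  have hd := fun l => differentiableAt_factor H hx l
  refine (dHol_ofReal_comp (R := fun l x => r l (coordProj m l x)) hφ
    (fun l => differentiableAt_comp_coordProj (hd l)) w).trans ?_
  exact Finset.sum_congr rfl fun l _ => by rw [← dHol_comp_clm (coordProj m l) (hd l)]

theorem dBar_comp_factorValues {φ : (Fin n → ℝ) → ℝ} {c : Fin n → ℝ}
    {x : (∀ l, Fin (m l) → ℂ) × (∀ l, Fin (m l) → ℂ)} (hx : x ∈ slitDomain U)
    (hφ : HasFDerivAt φ (∑ l, c l • ContinuousLinearMap.proj (R := ℝ) (φ := fun _ => ℝ) l)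
      (factorValues r x)) (w : (∀ l, Fin (m l) → ℂ) × (∀ l, Fin (m l) → ℂ)) :
    dBar w (composite φ r) x =
      ∑ l, (c l : ℂ) * dBar (coordProj m l w) (fun x => (r l x : ℂ)) (coordProj m l x) := by
  have hd := fun l => differentiableAt_factor H hx l
  refine (dBar_ofReal_comp (R := fun l x => r l (coordProj m l x)) hφ
    (fun l => differentiableAt_comp_coordProj (hd l)) w).trans ?_
  exact Finset.sum_congr rfl fun l _ => by rw [← dBar_comp_clm (coordProj m l) (hd l)]

theorem differentiableAt_composite {φ : (Fin n → ℝ) → ℝ} {c : Fin n → ℝ}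
    {x : (∀ l, Fin (m l) → ℂ) × (∀ l, Fin (m l) → ℂ)} (hx : x ∈ slitDomain U)
    (hφ : HasFDerivAt φ (∑ l, c l • ContinuousLinearMap.proj (R := ℝ) (φ := fun _ => ℝ) l)
      (factorValues r x)) : DifferentiableAt ℝ (composite φ r) x :=
  (fderiv_ofReal_comp (R := fun l x => r l (coordProj m l x)) hφ
    (fun l => differentiableAt_comp_coordProj (differentiableAt_factor H hx l))).differentiableAt

variable {F : (Fin n → ℝ) → ℝ} {F₁ : Fin n → (Fin n → ℝ) → ℝ}
  {F₂ : Fin n → Fin n → (Fin n → ℝ) → ℝ} {x : (∀ l, Fin (m l) → ℂ) × (∀ l, Fin (m l) → ℂ)}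

theorem dHol_fibreVec_comp_factorValues {φ : (Fin n → ℝ) → ℝ} {c : Fin n → ℝ}
    (hx : x ∈ slitDomain U)
    (hφ : HasFDerivAt φ (∑ l, c l • ContinuousLinearMap.proj (R := ℝ) (φ := fun _ => ℝ) l)
      (factorValues r x)) (i : Fin n) (a : Fin (m i)) :
    dHol (fibreVec (prodBasis m) ⟨i, a⟩) (composite φ r) x =
      c i * dHol (fibreVec (factorBasis (m i)) a) (fun x => (r i x : ℂ)) (coordProj m i x) := by
  rw [dHol_comp_factorValues H hx hφ, Finset.sum_eq_single i, coordProj_fibreVec_same]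
  · intro l _ hl
    rw [coordProj_fibreVec_ne hl, dHol_zero_left, mul_zero]
  · simp

theorem dBar_fibreVec_comp_factorValues {φ : (Fin n → ℝ) → ℝ} {c : Fin n → ℝ}
    (hx : x ∈ slitDomain U)
    (hφ : HasFDerivAt φ (∑ l, c l • ContinuousLinearMap.proj (R := ℝ) (φ := fun _ => ℝ) l)
      (factorValues r x)) (i : Fin n) (a : Fin (m i)) :
    dBar (fibreVec (prodBasis m) ⟨i, a⟩) (composite φ r) x =
      c i * dBar (fibreVec (factorBasis (m i)) a) (fun x => (r i x : ℂ)) (coordProj m i x) := by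
  rw [dBar_comp_factorValues H hx hφ, Finset.sum_eq_single i, coordProj_fibreVec_same]
  · intro l _ hl
    rw [coordProj_fibreVec_ne hl, dBar_zero_left, mul_zero]
  · simp

theorem dHol_baseVec_comp_factorValues {φ : (Fin n → ℝ) → ℝ} {c : Fin n → ℝ}
    (hx : x ∈ slitDomain U)
    (hφ : HasFDerivAt φ (∑ l, c l • ContinuousLinearMap.proj (R := ℝ) (φ := fun _ => ℝ) l)
      (factorValues r x)) (i : Fin n) (a : Fin (m i)) :
    dHol (baseVec (prodBasis m) ⟨i, a⟩) (composite φ r) x =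
      c i * dHol (baseVec (factorBasis (m i)) a) (fun x => (r i x : ℂ)) (coordProj m i x) := by
  rw [dHol_comp_factorValues H hx hφ, Finset.sum_eq_single i, coordProj_baseVec_same]
  · intro l _ hl
    rw [coordProj_baseVec_ne hl, dHol_zero_left, mul_zero]
  · simp

variable (hF : IsConvexIncreasing F F₁ F₂)
include hF

/-- Differentiating `F_j · ∂r_j/∂v̄^b` by the product rule. The first summand survives only for `i =
j`, since `coordProj` then kills the direction otherwise. -/
theorem leviMatrix_composite (hx : x ∈ slitDomain U) (i j : Fin n) (a : Fin (m i))
    (b : Fin (m j)) :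
    leviMatrix (prodBasis m) (composite F r) x ⟨i, a⟩ ⟨j, b⟩ =
      (F₁ j (factorValues r x) : ℂ) * dHol (coordProj m j (fibreVec (prodBasis m) ⟨i, a⟩))
        (dBar (fibreVec (factorBasis (m j)) b) (fun x => (r j x : ℂ))) (coordProj m j x) +
      F₂ j i (factorValues r x) *
        dHol (fibreVec (factorBasis (m i)) a) (fun x => (r i x : ℂ)) (coordProj m i x) *
        dBar (fibreVec (factorBasis (m j)) b) (fun x => (r j x : ℂ)) (coordProj m j x) := by
  have he : dBar (fibreVec (prodBasis m) ⟨j, b⟩) (composite F r) =ᶠ[𝓝 x] fun x =>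
      composite (F₁ j) r x *
        dBar (fibreVec (factorBasis (m j)) b) (fun x => (r j x : ℂ)) (coordProj m j x) := by
    filter_upwards [slitDomain_mem_nhds H hx] with y hy
    exact dBar_fibreVec_comp_factorValues H hy (hF.hasFDerivAt _ (factorValues_mem H hy)) j b
  have h1 := hF.hasFDerivAt_partial j _ (factorValues_mem H hx)
  have hd := ContDiffOn.differentiableAt_of_isOpen (H j).isOpen_prod (contDiffOn_dBar
    (H j).isOpen_prod (H j).contDiffOn (fibreVec (factorBasis (m j)) b))
      (x := coordProj m j x) ⟨hx.1 j, trivial⟩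
  rw [leviMatrix, Matrix.of_apply, dHol_congr he,
    dHol_mul (differentiableAt_composite H hx h1) (differentiableAt_comp_coordProj hd),
    dHol_comp_clm (coordProj m j) hd, dHol_fibreVec_comp_factorValues H hx h1]
  rfl

theorem dBar_dHol_composite (hx : x ∈ slitDomain U) (i j : Fin n) (a : Fin (m i))
    (b : Fin (m j)) :
    dBar (fibreVec (prodBasis m) ⟨i, a⟩) (dHol (baseVec (prodBasis m) ⟨j, b⟩) (composite F r)) x =
      (F₁ j (factorValues r x) : ℂ) * dBar (coordProj m j (fibreVec (prodBasis m) ⟨i, a⟩))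
        (dHol (baseVec (factorBasis (m j)) b) (fun x => (r j x : ℂ))) (coordProj m j x) +
      F₂ j i (factorValues r x) *
        dBar (fibreVec (factorBasis (m i)) a) (fun x => (r i x : ℂ)) (coordProj m i x) *
        dHol (baseVec (factorBasis (m j)) b) (fun x => (r j x : ℂ)) (coordProj m j x) := by
  have he : dHol (baseVec (prodBasis m) ⟨j, b⟩) (composite F r) =ᶠ[𝓝 x] fun x =>
      composite (F₁ j) r x *
        dHol (baseVec (factorBasis (m j)) b) (fun x => (r j x : ℂ)) (coordProj m j x) := by
    filter_upwards [slitDomain_mem_nhds H hx] with y hy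
    exact dHol_baseVec_comp_factorValues H hy (hF.hasFDerivAt _ (factorValues_mem H hy)) j b
  have h1 := hF.hasFDerivAt_partial j _ (factorValues_mem H hx)
  have hd := ContDiffOn.differentiableAt_of_isOpen (H j).isOpen_prod (contDiffOn_dHol
    (H j).isOpen_prod (H j).contDiffOn (baseVec (factorBasis (m j)) b))
      (x := coordProj m j x) ⟨hx.1 j, trivial⟩
  rw [dBar_congr he,
    dBar_mul (differentiableAt_composite H hx h1) (differentiableAt_comp_coordProj hd),
    dBar_comp_clm (coordProj m j) hd, dBar_fibreVec_comp_factorValues H hx h1]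
  rfl

end Product

/-- Uniqueness for the defining system: the connection can be guessed and checked, without inverting
the Levi matrix explicitly. -/
theorem connCoeff_eq_of_sum_mul_eq {E : Type*} [NormedAddCommGroup E] [NormedSpace ℂ E]
    {κ : Type*} [Fintype κ] [DecidableEq κ] {b : Module.Basis κ ℂ E} {G : E × E → ℂ} {x : E × E}
    (hA : IsUnit (leviMatrix b G x).det) {μ : κ} {C : κ → ℂ}
    (hC : ∀ t, ∑ a, leviMatrix b G x a t * C a = dBar (fibreVec b t) (dHol (baseVec b μ) G) x)
    (a : κ) : connCoeff b G a μ x = C a := by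
  have hinv : ∀ s, ∑ t, (leviMatrix b G x)⁻¹ t a * leviMatrix b G x s t =
      (1 : Matrix κ κ ℂ) s a := fun s => by
    rw [← Matrix.mul_nonsing_inv _ hA, Matrix.mul_apply]
    exact Finset.sum_congr rfl fun t _ => mul_comm _ _
  simp only [connCoeff, ← hC, Finset.mul_sum, ← mul_assoc]
  rw [Finset.sum_comm]
  simp only [← Finset.sum_mul, hinv]
  simp [Matrix.one_apply]

/-! ### Connection and curvature of a function of the factor metrics -/

section Product

variable {n : ℕ} {m : Fin n → ℕ} {U : ∀ l, Set (Fin (m l) → ℂ)}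
  {h : ∀ l, (Fin (m l) → ℂ) → Matrix (Fin (m l)) (Fin (m l)) ℂ}
  {r : ∀ l, (Fin (m l) → ℂ) × (Fin (m l) → ℂ) → ℝ}
  (H : ∀ l, IsHermitianCoeff (U l) (h l) (r l))
  {F : (Fin n → ℝ) → ℝ} {F₁ : Fin n → (Fin n → ℝ) → ℝ}
  {F₂ : Fin n → Fin n → (Fin n → ℝ) → ℝ} {x : (∀ l, Fin (m l) → ℂ) × (∀ l, Fin (m l) → ℂ)}
  (hF : IsConvexIncreasing F F₁ F₂)
include H hF

theorem sum_leviMatrix_composite_mul (hx : x ∈ slitDomain U) (j : Fin n) (b : Fin (m j))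
    (w : (Σ l, Fin (m l)) → ℂ) :
    ∑ α, leviMatrix (prodBasis m) (composite F r) x α ⟨j, b⟩ * w α =
      F₁ j (factorValues r x) * ∑ a, h j (x.1 j) a b * w ⟨j, a⟩ +
      (∑ i, F₂ j i (factorValues r x) * ∑ a, dHol (fibreVec (factorBasis (m i)) a)
        (fun x => (r i x : ℂ)) (coordProj m i x) * w ⟨i, a⟩) *
        dBar (fibreVec (factorBasis (m j)) b) (fun x => (r j x : ℂ)) (coordProj m j x) := by
  have hlevi : ∀ a, dHol (fibreVec (factorBasis (m j)) a) (dBar (fibreVec (factorBasis (m j)) b)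
      (fun x => (r j x : ℂ))) (coordProj m j x) = h j (x.1 j) a b := fun a =>
    congrFun (congrFun ((H j).leviMatrix_eq (x := coordProj m j x) (hx.1 j)) a) b
  rw [Fintype.sum_sigma]
  simp only [leviMatrix_composite H hF hx, add_mul, Finset.sum_add_distrib]
  congr 1
  · rw [Finset.sum_eq_single j, Finset.mul_sum]
    · simp only [coordProj_fibreVec_same, hlevi, mul_assoc]
    · intro i _ hi
      simp [coordProj_fibreVec_ne hi.symm, dHol_zero_left]
    · simp
  · rw [Finset.sum_mul]
    refine Finset.sum_congr rfl fun i _ => ?_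
    rw [Finset.mul_sum, Finset.sum_mul]
    exact Finset.sum_congr rfl fun a _ => by ring

/-- The Hermitian form of the Levi matrix is the sum of a positive definite part, weighted by the
`F_l`, and the positive semidefinite Hessian part; a null vector contradicts this. -/
theorem isUnit_det_leviMatrix_composite (hx : x ∈ slitDomain U) :
    IsUnit (leviMatrix (prodBasis m) (composite F r) x).det := by
  rw [isUnit_iff_ne_zero]
  intro h0
  obtain ⟨w, hw, hw0⟩ := Matrix.exists_vecMul_eq_zero_iff.2 h0
  set A : Fin n → ℂ := fun i => ∑ a, dHol (fibreVec (factorBasis (m i)) a)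
        (fun x => (r i x : ℂ)) (coordProj m i x) * w ⟨i, a⟩ with hA
  have hP := factorValues_mem H hx
  have h1 : ∀ j b, F₁ j (factorValues r x) * ∑ a, h j (x.1 j) a b * w ⟨j, a⟩ +
      (∑ i, F₂ j i (factorValues r x) * A i) * (starRingEnd ℂ)
        (dHol (fibreVec (factorBasis (m j)) b) (fun x => (r j x : ℂ)) (coordProj m j x)) = 0 := by
    intro j b
    rw [← (H j).dBar_fibreVec_eq_conj (x := coordProj m j x) (hx.1 j),
      ← sum_leviMatrix_composite_mul H hF hx j b w]
    exact (Finset.sum_congr rfl fun α _ => mul_comm _ _).trans (congrFun hw0 ⟨j, b⟩)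
  -- The null equation paired with the conjugate of `w`; `A` collects the values of the forms `∂r_i`
  -- on the blocks of `w`.
  have h2 : ∑ j, (F₁ j (factorValues r x) : ℂ) * (r j (x.1 j, fun a => w ⟨j, a⟩) : ℂ) +
      ∑ j, ∑ i, F₂ j i (factorValues r x) * A i * (starRingEnd ℂ) (A j) = 0 := by
    rw [← Finset.sum_add_distrib]
    refine Finset.sum_eq_zero fun j _ => ?_
    have h3 : ∑ b, (F₁ j (factorValues r x) * ∑ a, h j (x.1 j) a b * w ⟨j, a⟩ +
      (∑ i, F₂ j i (factorValues r x) * A i) * (starRingEnd ℂ)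
        (dHol (fibreVec (factorBasis (m j)) b) (fun x => (r j x : ℂ)) (coordProj m j x))) *
        (starRingEnd ℂ) (w ⟨j, b⟩) = 0 :=
      Finset.sum_eq_zero fun b _ => by rw [h1, zero_mul]
    rw [← h3, (H j).eq _ (hx.1 j), Finset.sum_comm]
    simp only [add_mul, Finset.sum_add_distrib]
    congr 1
    · simp only [Finset.mul_sum, Finset.sum_mul]
      exact Finset.sum_congr rfl fun b _ => Finset.sum_congr rfl fun a _ => by ring
    · rw [← Finset.sum_mul]
      simp only [hA, map_sum, map_mul, mul_assoc, Finset.mul_sum]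
  have h4 := congrArg Complex.re h2
  rw [Complex.add_re, Complex.zero_re] at h4
  have h5 := hF.posSemidef _ hP A
  simp only [← Complex.ofReal_mul, ← Complex.ofReal_sum, Complex.ofReal_re] at h4
  have h6 : 0 < ∑ j, F₁ j (factorValues r x) * r j (x.1 j, fun a => w ⟨j, a⟩) := by
    obtain ⟨⟨j, a⟩, hja⟩ := Function.ne_iff.1 hw
    refine Finset.sum_pos' (fun l _ => mul_nonneg (hF.pos l _ hP).le ((H l).nonneg (hx.1 l) _))
      ⟨j, Finset.mem_univ _, mul_pos (hF.pos j _ hP) ((H j).pos _ (hx.1 j) _ ?_)⟩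
    exact Function.ne_iff.2 ⟨a, hja⟩
  linarith

/-- The connection of `F(r_1, …, r_n)` is the direct sum of the connections of the `r_l`. -/
theorem connCoeff_composite (hx : x ∈ slitDomain U) (j : Fin n) (b : Fin (m j))
    (α : Σ l, Fin (m l)) :
    connCoeff (prodBasis m) (composite F r) α ⟨j, b⟩ x =
      (Pi.single j fun a => connCoeff (factorBasis (m j)) (fun x => (r j x : ℂ)) a b
        (coordProj m j x) : ∀ l, Fin (m l) → ℂ) α.1 α.2 := by
  refine connCoeff_eq_of_sum_mul_eq (isUnit_det_leviMatrix_composite H hF hx) (C := fun α =>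
    (Pi.single j fun a => connCoeff (factorBasis (m j)) (fun x => (r j x : ℂ)) a b
        (coordProj m j x) : ∀ l, Fin (m l) → ℂ) α.1 α.2) ?_ α
  rintro ⟨p, t⟩
  have hs := (H j).sum_dHol_mul_connCoeff (x := coordProj m j x) (hx.1 j) b
  rw [sum_leviMatrix_composite_mul H hF hx, dBar_dHol_composite H hF hx,
    Finset.sum_eq_single j]
  · simp only [Pi.single_eq_same]
    -- The zero horizontal derivative turns the contraction into `∂r_j/∂z^b`; symmetry of the
    -- Hessian then matches the second-derivative terms.
    rw [hs, hF.symm p j _ (factorValues_mem H hx)]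
    congr 1
    · rcases eq_or_ne p j with rfl | hp
      · rw [Pi.single_eq_same, coordProj_fibreVec_same,
          ← (H p).sum_mul_connCoeff (x := coordProj m p x) (hx.1 p)]
        rfl
      · simp [Pi.single_eq_of_ne hp, coordProj_fibreVec_ne hp.symm, dBar_zero_left]
    · ring
  · intro i _ hi
    simp [Pi.single_eq_of_ne hi]
  · simp

theorem connCoeff_composite_same (hx : x ∈ slitDomain U) (j : Fin n) (a b : Fin (m j)) :
    connCoeff (prodBasis m) (composite F r) ⟨j, a⟩ ⟨j, b⟩ =ᶠ[𝓝 x] fun x =>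
      connCoeff (factorBasis (m j)) (fun x => (r j x : ℂ)) a b (coordProj m j x) := by
  filter_upwards [slitDomain_mem_nhds H hx] with y hy
  rw [connCoeff_composite H hF hy, Pi.single_eq_same]

theorem connCoeff_composite_ne (hx : x ∈ slitDomain U) {i j : Fin n} (hij : i ≠ j)
    (a : Fin (m i)) (b : Fin (m j)) :
    connCoeff (prodBasis m) (composite F r) ⟨i, a⟩ ⟨j, b⟩ =ᶠ[𝓝 x] fun _ => 0 := by
  filter_upwards [slitDomain_mem_nhds H hx] with y hy
  rw [connCoeff_composite H hF hy, Pi.single_eq_of_ne hij, Pi.zero_apply]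

theorem deltaBar_connCoeff_composite_ne (hx : x ∈ slitDomain U) {i j : Fin n} (hij : i ≠ j)
    (a : Fin (m i)) (b : Fin (m j)) (μ : Σ l, Fin (m l)) :
    deltaBar (prodBasis m) (composite F r) μ
      (connCoeff (prodBasis m) (composite F r) ⟨i, a⟩ ⟨j, b⟩) x = 0 := by
  simp [deltaBar, dBar_congr (connCoeff_composite_ne H hF hx hij a b), dBar_zero_right]

/-- The coefficient involves only block `j`. Vertical derivatives in other blocks vanish for that
reason, and those in block `j` because it is holomorphic in `v`. -/
theorem deltaBar_connCoeff_composite (hx : x ∈ slitDomain U) (i j : Fin n)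
    (a b : Fin (m j)) (c : Fin (m i)) :
    deltaBar (prodBasis m) (composite F r) ⟨i, c⟩
      (connCoeff (prodBasis m) (composite F r) ⟨j, a⟩ ⟨j, b⟩) x =
      dBar (coordProj m j (baseVec (prodBasis m) ⟨i, c⟩))
        (connCoeff (factorBasis (m j)) (fun x => (r j x : ℂ)) a b) (coordProj m j x) := by
  have hd := (H j).differentiableAt_connCoeff (x := coordProj m j x) (hx.1 j) a b
  simp only [deltaBar, dBar_congr (connCoeff_composite_same H hF hx j a b),
    dBar_comp_clm (coordProj m j) hd]
  rw [sub_eq_self]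
  refine Finset.sum_eq_zero ?_
  rintro ⟨l, d⟩ -
  rcases eq_or_ne j l with rfl | hl
  · rw [coordProj_fibreVec_same, (H j).dBar_fibreVec_connCoeff (x := coordProj m j x) (hx.1 j),
      mul_zero]
  · rw [coordProj_fibreVec_ne hl, dBar_zero_left, mul_zero]

omit H hF in
/-- The numerator `∑ ∂G/∂v^γ δ_μ̄ (Γ^γ_{;α}) v^α conj (v^μ)` of the curvature. -/
noncomputable def curvSum {E : Type*} [NormedAddCommGroup E] [NormedSpace ℂ E]
    {κ : Type*} [Fintype κ] [DecidableEq κ] (b : Module.Basis κ ℂ E) (G : E × E → ℂ)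
    (x : E × E) : ℂ :=
  ∑ γ, ∑ α, ∑ μ, dHol (fibreVec b γ) G x *
    deltaBar b G μ (connCoeff b G γ α) x * b.repr x.2 α * (starRingEnd ℂ) (b.repr x.2 μ)

/-- Only terms with all three indices in one block survive, and there `∂G/∂v^γ` contributes the
factor `F_l`. -/
theorem curvSum_composite (hx : x ∈ slitDomain U) :
    curvSum (prodBasis m) (composite F r) x = ∑ l, F₁ l (factorValues r x) *
      curvSum (factorBasis (m l)) (fun x => (r l x : ℂ)) (coordProj m l x) := by
  rw [curvSum, Fintype.sum_sigma]
  refine Finset.sum_congr rfl fun l _ => ?_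
  rw [curvSum, Finset.mul_sum]
  refine Finset.sum_congr rfl fun a _ => ?_
  rw [Fintype.sum_sigma, Finset.sum_eq_single l, Finset.mul_sum]
  · refine Finset.sum_congr rfl fun b _ => ?_
    rw [Fintype.sum_sigma, Finset.sum_eq_single l, Finset.mul_sum]
    · refine Finset.sum_congr rfl fun c _ => ?_
      rw [deltaBar_connCoeff_composite H hF hx, coordProj_baseVec_same,
        (H l).deltaBar_connCoeff (x := coordProj m l x) (hx.1 l),
        dHol_fibreVec_comp_factorValues H hx (hF.hasFDerivAt _ (factorValues_mem H hx)),
        prodBasis_repr, prodBasis_repr, coordProj_apply]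
      simp only [Pi.basisFun_repr]
      ring
    · intro i _ hi
      refine Finset.sum_eq_zero fun c _ => ?_
      rw [deltaBar_connCoeff_composite H hF hx, coordProj_baseVec_ne hi.symm, dBar_zero_left]
      ring
    · simp
  · intro j _ hj
    refine Finset.sum_eq_zero fun b _ => Finset.sum_eq_zero fun μ _ => ?_
    rw [deltaBar_connCoeff_composite_ne H hF hx hj.symm]
    ring
  · simp

/-- The holomorphic sectional curvature of `F(r_1, …, r_n)` when the factors have constant
holomorphic sectional curvature. -/
theorem coordCurv_composite_re (hx : x ∈ slitDomain U) {c : ℝ}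
    (hc : ∀ l, x.2 l ≠ 0 → (coordCurv (factorBasis (m l)) (fun x => (r l x : ℂ))
      (coordProj m l x)).re = c) :
    (coordCurv (prodBasis m) (composite F r) x).re =
      c * (∑ l, F₁ l (factorValues r x) * factorValues r x l ^ 2) / F (factorValues r x) ^ 2 := by
  have h1 : ∀ l, (curvSum (factorBasis (m l)) (fun x => (r l x : ℂ)) (coordProj m l x)).re =
      -(c / 2) * factorValues r x l ^ 2 := by
    intro l
    -- The curvature hypothesis says nothing about zero blocks, but for these both sides vanish.
    by_cases hl : x.2 l = 0
    · have h0 := (H l).eq _ (hx.1 l) (x.2 l)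
      simp only [hl, Pi.zero_apply, mul_zero, map_zero, Finset.sum_const_zero] at h0
      have h0' : factorValues r x l = 0 := by
        rw [factorValues, coordProj_apply, hl]
        exact Complex.ofReal_eq_zero.1 h0
      simp [curvSum, coordProj_apply, hl, h0']
    · have hpos : 0 < factorValues r x l := (H l).pos _ (hx.1 l) _ hl
      have h2 := hc l hl
      have h3 : coordCurv (factorBasis (m l)) (fun x => (r l x : ℂ)) (coordProj m l x) =
          ((-(2 / factorValues r x l ^ 2) : ℝ) : ℂ) *
            curvSum (factorBasis (m l)) (fun x => (r l x : ℂ)) (coordProj m l x) := by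
        rw [coordCurv, curvSum]
        push_cast
        rfl
      rw [h3, Complex.re_ofReal_mul] at h2
      rw [← h2]
      field_simp
  have h4 : coordCurv (prodBasis m) (composite F r) x =
      ((-(2 / F (factorValues r x) ^ 2) : ℝ) : ℂ) * curvSum (prodBasis m) (composite F r) x := by
    rw [coordCurv, curvSum]
    push_cast
    rfl
  rw [h4, curvSum_composite H hF hx, Complex.re_ofReal_mul, Complex.re_sum]
  simp only [Complex.re_ofReal_mul, h1]
  rw [show ∑ l, F₁ l (factorValues r x) * (-(c / 2) * factorValues r x l ^ 2) =
    -(c / 2) * ∑ l, F₁ l (factorValues r x) * factorValues r x l ^ 2 by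
      rw [Finset.mul_sum]; exact Finset.sum_congr rfl fun l _ => by ring]
  ring

end Product

/-! ### Locality of the curvature -/

section Congr

variable {E : Type*} [NormedAddCommGroup E] [NormedSpace ℂ E]
  {κ : Type*} [Fintype κ] [DecidableEq κ] (b : Module.Basis κ ℂ E)

theorem dHol_eventuallyEq {f g : E → ℂ} {x : E} (h : f =ᶠ[𝓝 x] g) (w : E) :
    dHol w f =ᶠ[𝓝 x] dHol w g := by
  filter_upwards [h.eventuallyEq_nhds] with y hy using dHol_congr hy w

theorem dBar_eventuallyEq {f g : E → ℂ} {x : E} (h : f =ᶠ[𝓝 x] g) (w : E) :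
    dBar w f =ᶠ[𝓝 x] dBar w g := by
  filter_upwards [h.eventuallyEq_nhds] with y hy using dBar_congr hy w

theorem connCoeff_congr {G G' : E × E → ℂ} {x : E × E} (h : G =ᶠ[𝓝 x] G') (a μ : κ) :
    connCoeff b G a μ x = connCoeff b G' a μ x := by
  have hl : leviMatrix b G x = leviMatrix b G' x := by
    ext i j
    exact dHol_congr (dBar_eventuallyEq h _) _
  simp only [connCoeff, hl, dBar_congr (dHol_eventuallyEq h _)]

theorem coordCurv_congr {G G' : E × E → ℂ} {x : E × E} (h : G =ᶠ[𝓝 x] G') :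
    coordCurv b G x = coordCurv b G' x := by
  have hc : ∀ a μ, connCoeff b G a μ =ᶠ[𝓝 x] connCoeff b G' a μ := fun a μ => by
    filter_upwards [h.eventuallyEq_nhds] with y hy using connCoeff_congr b hy a μ
  simp only [coordCurv, deltaBar, h.self_of_nhds, dHol_congr h, dBar_congr (hc _ _),
    connCoeff_congr b h]

end Congr

/-! ### Hermitian metrics in charts -/

section Metric

theorem ComplexFinsler.HermitianMetric.quad_nonneg {E : Type*} [NormedAddCommGroup E]
    [NormedSpace ℂ E] {H : Type*} [TopologicalSpace H] {I : ModelWithCorners ℂ E H} {M : Type*}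
    [TopologicalSpace M] [ChartedSpace H M] [IsManifold I 1 M] (Q : HermitianMetric I M)
    (v : TangentBundle I M) : 0 ≤ Q.quad v := by
  by_cases hv : v.2 = 0
  · rw [HermitianMetric.quad, hv]
    simp
  · exact (Q.pos _ _ hv).le

variable {d : ℕ} {M : Type*} [TopologicalSpace M] [ChartedSpace (Fin d → ℂ) M]
  [IsManifold 𝓘(ℂ, Fin d → ℂ) 1 M] (Q : HermitianMetric 𝓘(ℂ, Fin d → ℂ) M)
  (v₀ : TangentBundle 𝓘(ℂ, Fin d → ℂ) M)

local notation "II" => 𝓘(ℂ, Fin d → ℂ)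

/-- The linear map from the coordinates of a tangent vector to the tangent vector. -/
noncomputable def chartFrame (z : Fin d → ℂ) :
    (Fin d → ℂ) →ₗ[ℂ] TangentSpace II ((extChartAt II v₀.1).symm z) :=
  (tangentCoordChange II v₀.1 ((extChartAt II v₀.1).symm z)
    ((extChartAt II v₀.1).symm z)).toLinearMap

/-- The coefficients of a Hermitian metric in a chart. -/
noncomputable def chartCoeff (z : Fin d → ℂ) : Matrix (Fin d) (Fin d) ℂ :=
  Matrix.of fun a b => Q.form ((extChartAt II v₀.1).symm z)
    (chartFrame v₀ z (Pi.single b 1)) (chartFrame v₀ z (Pi.single a 1))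

theorem inChart_quad (z w : Fin d → ℂ) : inChart II Q.quad v₀ (z, w) =
    (Q.form ((extChartAt II v₀.1).symm z) (chartFrame v₀ z w) (chartFrame v₀ z w)).re := by
  rw [inChart, extChartAt_tangent_symm_apply]
  rfl

theorem ofReal_inChart_quad (z w : Fin d → ℂ) : (inChart II Q.quad v₀ (z, w) : ℂ) =
    Q.form ((extChartAt II v₀.1).symm z) (chartFrame v₀ z w) (chartFrame v₀ z w) := by
  rw [inChart_quad]
  exact Complex.conj_eq_iff_re.1 (Q.conj_symm _ _ _)

/-- The frame map is a coordinate change of the tangent bundle, inverted by the reverse change. -/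
theorem chartFrame_ne_zero {z : Fin d → ℂ} (hz : z ∈ (extChartAt II v₀.1).target)
    {w : Fin d → ℂ} (hw : w ≠ 0) : chartFrame v₀ z w ≠ 0 := by
  intro h
  have hs := (extChartAt II v₀.1).map_target hz
  have h1 := tangentCoordChange_comp (I := II) (w := v₀.1)
    (x := (extChartAt II v₀.1).symm z) (y := v₀.1) (z := (extChartAt II v₀.1).symm z) (v := w)
    ⟨⟨hs, mem_extChartAt_source _⟩, hs⟩
  rw [tangentCoordChange_self hs] at h1
  apply hw
  rw [← h1]
  exact (congrArg (tangentCoordChange II ((extChartAt II v₀.1).symm z) v₀.1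
    ((extChartAt II v₀.1).symm z)) h).trans (map_zero _)

/-- Smoothness is only given for the quadratic function; polarization transfers it to the
coefficients. -/
theorem chartCoeff_polarization (z : Fin d → ℂ) (a b : Fin d) :
    chartCoeff Q v₀ z a b = (1 / 4 : ℂ) *
      ((inChart II Q.quad v₀ (z, Pi.single a 1 + Pi.single b 1) : ℂ) -
        inChart II Q.quad v₀ (z, Pi.single a 1 - Pi.single b 1) +
        Complex.I * inChart II Q.quad v₀ (z, Pi.single a 1 + Complex.I • Pi.single b 1) -
        Complex.I * inChart II Q.quad v₀ (z, Pi.single a 1 - Complex.I • Pi.single b 1)) := by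
  simp only [ofReal_inChart_quad, chartCoeff, Matrix.of_apply, map_add, map_sub, map_smul,
    LinearMap.map_smulₛₗ, LinearMap.add_apply, LinearMap.sub_apply, LinearMap.smul_apply,
    smul_eq_mul, Complex.conj_I]
  linear_combination (-1 / 2 *
    (Q.form ((extChartAt II v₀.1).symm z)) (chartFrame v₀ z (Pi.single a 1))
      (chartFrame v₀ z (Pi.single b 1)) + 1 / 2 *
    (Q.form ((extChartAt II v₀.1).symm z)) (chartFrame v₀ z (Pi.single b 1))
      (chartFrame v₀ z (Pi.single a 1))) * Complex.I_mul_I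

theorem isHermitianCoeff_chartCoeff :
    IsHermitianCoeff (extChartAt II v₀.1).target (chartCoeff Q v₀) (inChart II Q.quad v₀) where
  isOpen := isOpen_extChartAt_target v₀.1
  smooth a b := by
    have hs : ContDiffOn ℝ ∞ (fun x => (inChart II Q.quad v₀ x : ℂ))
        ((extChartAt II v₀.1).target ×ˢ Set.univ) := by
      have h := Q.smooth v₀
      rw [extChartAt_tangent_target] at h
      exact Complex.ofRealCLM.contDiff.comp_contDiffOn h
    have hw : ∀ w : Fin d → ℂ, ContDiffOn ℝ ∞ (fun z => (inChart II Q.quad v₀ (z, w) : ℂ))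
        (extChartAt II v₀.1).target := fun w =>
      hs.comp (f := fun z => (z, w)) (by fun_prop) fun z hz => ⟨hz, trivial⟩
    simp only [chartCoeff_polarization]
    exact contDiffOn_const.mul ((((hw _).sub (hw _)).add (contDiffOn_const.mul (hw _))).sub
      (contDiffOn_const.mul (hw _)))
  conj z a b := Q.conj_symm _ _ _
  eq z _ w := by
    rw [ofReal_inChart_quad]
    have hw : chartFrame v₀ z w = ∑ a, w a • chartFrame v₀ z (Pi.single a 1) := by
      conv_lhs => rw [pi_eq_sum_univ' w, map_sum]
      simp only [map_smul]
    rw [hw]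
    simp only [map_sum, LinearMap.map_smulₛₗ, LinearMap.sum_apply, LinearMap.smul_apply,
      smul_eq_mul, map_smul, chartCoeff, Matrix.of_apply]
    refine Finset.sum_congr rfl fun a _ => ?_
    rw [Finset.mul_sum]
    exact Finset.sum_congr rfl fun b _ => by ring
  pos z hz w hw := by
    rw [inChart_quad]
    exact Q.pos _ _ (chartFrame_ne_zero v₀ hz hw)

theorem holSecCurv_finsler (v : TangentBundle II M) :
    holSecCurv II (factorBasis d) Q.finsler v =
      (coordCurv (factorBasis d) (fun x => (inChart II Q.quad v x : ℂ))
        (extChartAt (II).tangent v v)).re := by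
  have h : ∀ x, inChart II Q.finsler v x ^ 2 = inChart II Q.quad v x := fun x =>
    Real.sq_sqrt (Q.quad_nonneg _)
  simp only [holSecCurv, h]

end Metric

/-! ### From charts to the product manifold -/

section ProductMetric

variable {n : ℕ} {m : Fin n → ℕ} {M : Fin n → Type*} [∀ l, TopologicalSpace (M l)]
  [∀ l, ChartedSpace (Fin (m l) → ℂ) (M l)] [∀ l, IsManifold 𝓘(ℂ, Fin (m l) → ℂ) ω (M l)]

/-- The values `Q_l(π_l(z), (π_l)_*(v))`. -/
noncomputable def quadValues (Q : ∀ l, HermitianMetric 𝓘(ℂ, Fin (m l) → ℂ) (M l))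
    (v : TangentBundle (prodModel m) (∀ l, M l)) (l : Fin n) : ℝ :=
  (Q l).quad (projTangent m M l v)

theorem quadValues_mem {Q : ∀ l, HermitianMetric 𝓘(ℂ, Fin (m l) → ℂ) (M l)}
    {v : TangentBundle (prodModel m) (∀ l, M l)} (hv : v.2 ≠ 0) :
    quadValues Q v ∈ puncturedOrthant n := by
  refine ⟨fun l => (Q l).quad_nonneg _, ?_⟩
  obtain ⟨l, hl⟩ := Function.ne_iff.1 hv
  refine ⟨l, (Q l).pos _ _ ?_⟩
  rw [projTangent_eq]
  exact hl

/-- Near the given vector `Φ²` in the product chart is `F` of the factor quadratic functions, and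
the curvature depends only on this germ. -/
theorem holSecCurv_product {Q : ∀ l, HermitianMetric 𝓘(ℂ, Fin (m l) → ℂ) (M l)} {c : ℝ}
    (hc : ∀ (l : Fin n) (v : TangentBundle 𝓘(ℂ, Fin (m l) → ℂ) (M l)), v.2 ≠ 0 →
      holSecCurv 𝓘(ℂ, Fin (m l) → ℂ) (factorBasis (m l)) (Q l).finsler v = c)
    {F : (Fin n → ℝ) → ℝ} {F₁ : Fin n → (Fin n → ℝ) → ℝ} {F₂ : Fin n → Fin n → (Fin n → ℝ) → ℝ}
    (hF : IsConvexIncreasing F F₁ F₂) {Φ : TangentBundle (prodModel m) (∀ l, M l) → ℝ}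
    (hΦ : ∀ v, Φ v ^ 2 = F (quadValues Q v))
    {v : TangentBundle (prodModel m) (∀ l, M l)} (hv : v.2 ≠ 0) :
    holSecCurv (prodModel m) (prodBasis m) Φ v =
      c * (∑ l, F₁ l (quadValues Q v) * quadValues Q v l ^ 2) / F (quadValues Q v) ^ 2 := by
  set r : ∀ l, (Fin (m l) → ℂ) × (Fin (m l) → ℂ) → ℝ := fun l =>
    inChart 𝓘(ℂ, Fin (m l) → ℂ) (Q l).quad (projTangent m M l v) with hr
  set x := extChartAt (prodModel m).tangent v v with hxdef
  have H := fun l => isHermitianCoeff_chartCoeff (Q l) (projTangent m M l v)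
  have hbase : ∀ l, (projTangent m M l v).1 = v.1 l := fun l => rfl
  have hx0 : x = (extChartAt (prodModel m) v.1 v.1, v.2) := extChartAt_tangent_self v
  have hx : x ∈ slitDomain fun l =>
      (extChartAt 𝓘(ℂ, Fin (m l) → ℂ) (projTangent m M l v).1).target := by
    rw [hx0]
    exact ⟨fun l => mem_extChartAt_target (I := 𝓘(ℂ, Fin (m l) → ℂ)) (v.1 l), hv⟩
  have hxl : ∀ l, extChartAt (𝓘(ℂ, Fin (m l) → ℂ)).tangent (projTangent m M l v)
      (projTangent m M l v) = coordProj m l x := fun l => by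
    rw [extChartAt_tangent_self, hx0, projTangent_eq]
    rfl
  have hval : factorValues r x = quadValues Q v := by
    funext l
    rw [factorValues, ← hxl]
    simp only [hr, inChart, quadValues]
    rw [extChartAt_to_inv]
  have he : (fun x => ((inChart (prodModel m) Φ v x ^ 2 : ℝ) : ℂ)) =ᶠ[𝓝 x] composite F r := by
    filter_upwards [slitDomain_mem_nhds H hx] with y hy
    have hy1 : y.1 ∈ (extChartAt (prodModel m) v.1).target :=
      (mem_extChartAt_prodModel_target _ _).2 hy.1
    simp only [composite, inChart, hΦ]
    congr 2
    funext l
    rw [quadValues, projTangent_extChartAt_symm l v hy1]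
    rfl
  rw [holSecCurv, coordCurv_congr (prodBasis m) he, coordCurv_composite_re H hF hx (c := c), hval]
  intro l hl
  rw [← hxl, ← holSecCurv_finsler]
  refine hc l _ ?_
  rw [projTangent_eq]
  rw [hx0] at hl
  exact hl

end ProductMetric

/-! ### The mean defining the metric: derivatives and convexity -/

section PowerSum

variable {n : ℕ}

/-- The power sum `∑ y_l ^ k`. -/
def powerSum (k : ℕ) (y : Fin n → ℝ) : ℝ := ∑ l, y l ^ k

theorem powerSum_pos {y : Fin n → ℝ} (hy : y ∈ puncturedOrthant n) (k : ℕ) :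
    0 < powerSum k y := by
  obtain ⟨h0, l, hl⟩ := hy
  exact Finset.sum_pos' (fun j _ => pow_nonneg (h0 j) k) ⟨l, Finset.mem_univ _, pow_pos hl k⟩

theorem hasFDerivAt_powerSum (k : ℕ) (y : Fin n → ℝ) :
    HasFDerivAt (powerSum (k + 1)) (∑ l, ((k + 1) * y l ^ k) •
      ContinuousLinearMap.proj (R := ℝ) (φ := fun _ => ℝ) l) y := by
  refine HasFDerivAt.fun_sum fun l _ => ?_
  refine ((ContinuousLinearMap.proj (R := ℝ) (φ := fun _ : Fin n => ℝ) l).hasFDerivAt.pow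
    (k + 1)).congr_fderiv ?_
  ext w
  simp

/-- The function `(∑ y_l + t (∑ y_l ^ k) ^ (1 / k)) / (1 + t)`. -/
noncomputable def mixedNorm (t : ℝ) (k : ℕ) (y : Fin n → ℝ) : ℝ :=
  1 / (1 + t) * (∑ l, y l + t * powerSum k y ^ (1 / (k : ℝ)))

/-- The partial derivatives of `mixedNorm t (p + 2)`. -/
noncomputable def mixedNormPartial (t : ℝ) (p : ℕ) (l : Fin n) (y : Fin n → ℝ) : ℝ :=
  1 / (1 + t) * (1 + t * (y l ^ (p + 1) * powerSum (p + 2) y ^ (1 / ((p + 2 : ℕ) : ℝ) - 1)))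

/-- The Hessian of `mixedNorm t (p + 2)`. -/
noncomputable def mixedNormHessian (t : ℝ) (p : ℕ) (l j : Fin n) (y : Fin n → ℝ) : ℝ :=
  t / (1 + t) * (p + 1) * ((if l = j then y l ^ p else 0) *
    powerSum (p + 2) y ^ (1 / ((p + 2 : ℕ) : ℝ) - 1) -
    y l ^ (p + 1) * y j ^ (p + 1) * powerSum (p + 2) y ^ (1 / ((p + 2 : ℕ) : ℝ) - 2))

theorem hasFDerivAt_mixedNorm (t : ℝ) (p : ℕ) {y : Fin n → ℝ} (hy : y ∈ puncturedOrthant n) :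
    HasFDerivAt (mixedNorm t (p + 2)) (∑ l, mixedNormPartial t p l y •
      ContinuousLinearMap.proj (R := ℝ) (φ := fun _ => ℝ) l) y := by
  have hs := powerSum_pos hy (p + 2)
  have h1 : HasFDerivAt (fun y : Fin n → ℝ => ∑ l, y l)
      (∑ l, ContinuousLinearMap.proj (R := ℝ) (φ := fun _ => ℝ) l) y :=
    HasFDerivAt.fun_sum fun l _ =>
      (ContinuousLinearMap.proj (R := ℝ) (φ := fun _ : Fin n => ℝ) l).hasFDerivAt
  have h2 := (hasFDerivAt_powerSum (p + 1) y).rpow_const (p := 1 / ((p + 2 : ℕ) : ℝ))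
    (Or.inl hs.ne')
  refine ((h1.add (h2.const_mul t)).const_mul (1 / (1 + t))).congr_fderiv ?_
  ext w
  simp only [smul_apply, add_apply, sum_apply, smul_eq_mul, ContinuousLinearMap.proj_apply,
    mixedNormPartial, Finset.mul_sum, ← Finset.sum_add_distrib]
  refine Finset.sum_congr rfl fun l _ => ?_
  have hp : ((p : ℝ) + 2) ≠ 0 := by positivity
  push_cast
  field_simp
  ring

theorem hasFDerivAt_mixedNormPartial (t : ℝ) (p : ℕ) (l : Fin n) {y : Fin n → ℝ}
    (hy : y ∈ puncturedOrthant n) :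
    HasFDerivAt (mixedNormPartial t p l) (∑ j, mixedNormHessian t p l j y •
      ContinuousLinearMap.proj (R := ℝ) (φ := fun _ => ℝ) j) y := by
  have hs := powerSum_pos hy (p + 2)
  have h1 := ((ContinuousLinearMap.proj (R := ℝ) (φ := fun _ : Fin n => ℝ) l).hasFDerivAt
    (x := y)).pow (p + 1)
  have h2 := (hasFDerivAt_powerSum (p + 1) y).rpow_const (p := 1 / ((p + 2 : ℕ) : ℝ) - 1)
    (Or.inl hs.ne')
  refine ((((h1.mul h2).const_mul t).const_add 1).const_mul (1 / (1 + t))).congr_fderiv ?_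
  ext w
  -- The diagonal term is spread over a sum in `j`, so that coefficients can be compared one by one.
  have hw : (p + 1 : ℝ) * y l ^ p * w l = ∑ j, (if l = j then (p + 1 : ℝ) * y l ^ p else 0) * w j := by
    simp
  simp only [smul_apply, add_apply, sum_apply, smul_eq_mul, ContinuousLinearMap.proj_apply,
    mixedNormHessian, Nat.add_sub_cancel, nsmul_eq_mul, Nat.cast_add, Nat.cast_one]
  rw [hw]
  simp only [Finset.mul_sum, ← Finset.sum_add_distrib]
  refine Finset.sum_congr rfl fun j _ => ?_
  have hp : ((p : ℝ) + 2) ≠ 0 := by positivity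
  rw [show (1 / ((p : ℝ) + (2 : ℕ)) - 1 - 1) = 1 / ((p : ℝ) + (2 : ℕ)) - 2 by ring]
  have hk : (1 / ((p : ℝ) + 2) - 1) * (p + 2) = -(p + 1) := by field_simp; ring
  push_cast
  rw [show (p : ℝ) + 1 + 1 = p + 2 by ring]
  split_ifs
  · linear_combination (1 / (1 + t) * t * y l ^ (p + 1) * y j ^ (p + 1) * w j *
      powerSum (p + 2) y ^ (1 / ((p : ℝ) + 2) - 2)) * hk
  · linear_combination (1 / (1 + t) * t * y l ^ (p + 1) * y j ^ (p + 1) * w j *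
      powerSum (p + 2) y ^ (1 / ((p : ℝ) + 2) - 2)) * hk

/-- Cauchy-Schwarz, based on `(y^{p+1} ‖A‖)² = y^{p+2} · (y^p ‖A‖²)`. It is exactly the
semidefiniteness of the Hessian of the `k`-norm, `k = p + 2`. -/
theorem norm_sq_sum_le (p : ℕ) {y : Fin n → ℝ} (hy : ∀ l, 0 ≤ y l) (A : Fin n → ℂ) :
    ‖∑ l, (y l ^ (p + 1) : ℝ) * A l‖ ^ 2 ≤ powerSum (p + 2) y * ∑ l, y l ^ p * ‖A l‖ ^ 2 := by
  have h1 : ‖∑ l, (y l ^ (p + 1) : ℝ) * A l‖ ≤ ∑ l, y l ^ (p + 1) * ‖A l‖ := by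
    refine (norm_sum_le _ _).trans_eq (Finset.sum_congr rfl fun l _ => ?_)
    rw [norm_mul, Complex.norm_real, Real.norm_of_nonneg (pow_nonneg (hy l) _)]
  refine (pow_le_pow_left₀ (norm_nonneg _) h1 2).trans ?_
  refine Finset.sum_sq_le_sum_mul_sum_of_sq_le_mul _ (fun l _ => pow_nonneg (hy l) _)
    (fun l _ => mul_nonneg (pow_nonneg (hy l) _) (sq_nonneg _)) fun l _ => le_of_eq ?_
  ring

theorem isConvexIncreasing_mixedNorm {t : ℝ} (ht : 0 ≤ t) (p : ℕ) :
    IsConvexIncreasing (n := n) (mixedNorm t (p + 2)) (mixedNormPartial t p)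
      (mixedNormHessian t p) where
  hasFDerivAt y hy := hasFDerivAt_mixedNorm t p hy
  hasFDerivAt_partial l y hy := hasFDerivAt_mixedNormPartial t p l hy
  symm l j y _ := by
    rcases eq_or_ne l j with rfl | h
    · rfl
    · simp only [mixedNormHessian, h, h.symm, if_false]
      ring
  pos l y hy := by
    have h1 := Real.rpow_nonneg (powerSum_pos hy (p + 2)).le (1 / ((p + 2 : ℕ) : ℝ) - 1)
    have h2 := pow_nonneg (hy.1 l) (p + 1)
    unfold mixedNormPartial
    positivity
  posSemidef y hy A := by
    have hs := powerSum_pos hy (p + 2)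
    set s := powerSum (p + 2) y with hsdef
    set e : ℝ := 1 / ((p + 2 : ℕ) : ℝ) with he
    -- Extracting the common power `s ^ (e - 2)` leaves the Cauchy-Schwarz difference.
    have hse : s ^ (e - 1) = s * s ^ (e - 2) := by
      rw [← Real.rpow_one_add' hs.le]
      · congr 1; ring
      · have h2 : e ≠ 1 := by
          rw [he]; push_cast
          rw [ne_eq, div_eq_one_iff_eq (by positivity)]
          linarith [(Nat.cast_nonneg p : (0 : ℝ) ≤ p)]
        intro h
        apply h2
        linarith
    set B : ℂ := ∑ l, (y l ^ (p + 1) : ℝ) * A l with hB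
    have hsum : ∑ l, ∑ j, (mixedNormHessian t p l j y : ℂ) * A j * (starRingEnd ℂ) (A l) =
        ((t / (1 + t) * (p + 1) * s ^ (e - 2) *
          (s * ∑ l, y l ^ p * ‖A l‖ ^ 2 - ‖B‖ ^ 2) : ℝ) : ℂ) := by
      have h1 : ((∑ l, y l ^ p * ‖A l‖ ^ 2 : ℝ) : ℂ) =
          ∑ l, ∑ j, (if l = j then (y l : ℂ) ^ p else 0) * A j * (starRingEnd ℂ) (A l) := by
        push_cast
        refine Finset.sum_congr rfl fun l _ => ?_
        simp only [ite_mul, zero_mul, Finset.sum_ite_eq, Finset.mem_univ, if_true, mul_assoc,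
          Complex.mul_conj']
      have h2 : ((‖B‖ ^ 2 : ℝ) : ℂ) = ∑ l, ∑ j, (y l : ℂ) ^ (p + 1) * (y j : ℂ) ^ (p + 1) * A j *
          (starRingEnd ℂ) (A l) := by
        push_cast
        rw [← Complex.mul_conj', hB, map_sum, Finset.sum_mul_sum, Finset.sum_comm]
        refine Finset.sum_congr rfl fun l _ => Finset.sum_congr rfl fun j _ => ?_
        simp only [map_mul, Complex.conj_ofReal]
        push_cast
        ring
      rw [Complex.ofReal_mul, Complex.ofReal_sub, Complex.ofReal_mul s, h1, h2]
      simp only [Finset.mul_sum, ← Finset.sum_sub_distrib]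
      refine Finset.sum_congr rfl fun l _ => Finset.sum_congr rfl fun j _ => ?_
      simp only [mixedNormHessian, ← hsdef, ← he, hse]
      split_ifs <;> push_cast <;> ring
    rw [hsum, Complex.ofReal_re]
    have h3 := norm_sq_sum_le p hy.1 A
    have h4 := Real.rpow_nonneg hs.le (e - 2)
    exact mul_nonneg (by positivity) (sub_nonneg.2 h3)

end PowerSum

/-! ### Bounds and limits of the curvature ratio -/

section Bounds

variable {n : ℕ}

/-- The ratio of the holomorphic sectional curvature of the product to that of the factors. -/
noncomputable def curvRatio (t : ℝ) (p : ℕ) (y : Fin n → ℝ) : ℝ :=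
  (∑ l, mixedNormPartial t p l y * y l ^ 2) / mixedNorm t (p + 2) y ^ 2

variable {y : Fin n → ℝ} (hy : y ∈ puncturedOrthant n) (p : ℕ)

theorem sum_mixedNormPartial_mul_sq (t : ℝ) (y : Fin n → ℝ) :
    ∑ l, mixedNormPartial t p l y * y l ^ 2 = 1 / (1 + t) * (powerSum 2 y +
      t * (powerSum (p + 2) y ^ (1 / ((p + 2 : ℕ) : ℝ) - 1) * powerSum (p + 3) y)) := by
  simp only [mixedNormPartial, powerSum, Finset.mul_sum, ← Finset.sum_add_distrib]
  exact Finset.sum_congr rfl fun l _ => by ring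

include hy

theorem rpow_sub_one_mul_powerSum : powerSum (p + 2) y ^ (1 / ((p + 2 : ℕ) : ℝ) - 1) *
    powerSum (p + 2) y = powerSum (p + 2) y ^ (1 / ((p + 2 : ℕ) : ℝ)) := by
  have hs := powerSum_pos hy (p + 2)
  rw [Real.rpow_sub_one hs.ne', div_mul_cancel₀ _ hs.ne']

theorem le_powerSum_rpow (l : Fin n) : y l ≤ powerSum (p + 2) y ^ (1 / ((p + 2 : ℕ) : ℝ)) := by
  have hs := powerSum_pos hy (p + 2)
  rw [← pow_le_pow_iff_left₀ (hy.1 l) (Real.rpow_nonneg hs.le _) (n := p + 2) (by omega), one_div,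
    Real.rpow_inv_natCast_pow hs.le (by omega)]
  exact Finset.single_le_sum (f := fun l => y l ^ (p + 2)) (fun j _ => pow_nonneg (hy.1 j) _)
    (Finset.mem_univ l)

theorem mixedNorm_pos {t : ℝ} (ht : 0 ≤ t) : 0 < mixedNorm t (p + 2) y := by
  have h1 : 0 < ∑ l, y l := by simpa [powerSum] using powerSum_pos hy 1
  have h2 := Real.rpow_nonneg (powerSum_pos hy (p + 2)).le (1 / ((p + 2 : ℕ) : ℝ))
  unfold mixedNorm
  positivity

theorem curvRatio_eq {t : ℝ} (ht : 0 ≤ t) : curvRatio t p y = (1 + t) * (powerSum 2 y +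
      t * (powerSum (p + 2) y ^ (1 / ((p + 2 : ℕ) : ℝ) - 1) * powerSum (p + 3) y)) /
      (∑ l, y l + t * powerSum (p + 2) y ^ (1 / ((p + 2 : ℕ) : ℝ))) ^ 2 := by
  have h := mixedNorm_pos hy p ht
  rw [curvRatio, sum_mixedNormPartial_mul_sq]
  rw [mixedNorm] at h ⊢
  have h1 : (1 + t) ≠ 0 := by positivity
  have h2 := (pos_of_mul_pos_right h (by positivity)).ne'
  field_simp

/-- Every `y l` is at most the sum `S` and at most the `k`-norm `N`. Hence `∑ y²` is at most `S²`
and `NS`, while `σ ∑ y^{k+1}` is at most `SN` and `N²`. -/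
theorem curvRatio_le_one {t : ℝ} (ht : 0 ≤ t) : curvRatio t p y ≤ 1 := by
  rw [curvRatio_eq hy p ht]
  have hs := powerSum_pos hy (p + 2)
  have hσs := rpow_sub_one_mul_powerSum hy p
  have hle := le_powerSum_rpow hy p
  have hS1 : 0 < ∑ l, y l := by simpa [powerSum] using powerSum_pos hy 1
  have hσ0 : 0 ≤ powerSum (p + 2) y ^ (1 / ((p + 2 : ℕ) : ℝ) - 1) := Real.rpow_nonneg hs.le _
  have hN0 : 0 ≤ powerSum (p + 2) y ^ (1 / ((p + 2 : ℕ) : ℝ)) := Real.rpow_nonneg hs.le _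
  set σ := powerSum (p + 2) y ^ (1 / ((p + 2 : ℕ) : ℝ) - 1)
  set N := powerSum (p + 2) y ^ (1 / ((p + 2 : ℕ) : ℝ))
  set S := ∑ l, y l with hS
  have hyS : ∀ l, y l ≤ S := fun l =>
    Finset.single_le_sum (fun j _ => hy.1 j) (Finset.mem_univ l)
  have h1 : powerSum 2 y ≤ S * S := by
    rw [powerSum, hS, Finset.mul_sum]
    exact Finset.sum_le_sum fun l _ => by
      rw [sq]; exact mul_le_mul_of_nonneg_right (hyS l) (hy.1 l)
  have h2 : powerSum 2 y ≤ N * S := by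
    rw [powerSum, hS, Finset.mul_sum]
    exact Finset.sum_le_sum fun l _ => by
      rw [sq]; exact mul_le_mul_of_nonneg_right (hle l) (hy.1 l)
  have h3 : ∀ C, (∀ l, y l ≤ C) → σ * powerSum (p + 3) y ≤ C * N := fun C hC => by
    rw [← hσs, mul_left_comm]
    refine mul_le_mul_of_nonneg_left ?_ hσ0
    rw [powerSum, powerSum, Finset.mul_sum]
    exact Finset.sum_le_sum fun l _ => by
      rw [pow_succ']; exact mul_le_mul_of_nonneg_right (hC l) (pow_nonneg (hy.1 l) _)
  have h4 := h3 S hyS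
  have h5 := h3 N hle
  rw [div_le_one (by positivity)]
  -- The comparison with `(S + tN)²` is made power by power in `t`, the coefficient of `t` using
  -- both `h2` and `h4`.
  nlinarith [mul_le_mul_of_nonneg_left h2 ht, mul_le_mul_of_nonneg_left h4 ht,
    mul_le_mul_of_nonneg_left h5 (mul_nonneg ht ht)]

/-- The power mean inequality between the exponents `k - 1` and `k`. -/
theorem rpow_mul_powerSum_pred_le : powerSum (p + 2) y ^ (1 / ((p + 2 : ℕ) : ℝ) - 1) *
    powerSum (p + 1) y ≤ (n : ℝ) ^ (1 / ((p + 2 : ℕ) : ℝ)) := by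
  have hs := powerSum_pos hy (p + 2)
  have hp0 : (0 : ℝ) ≤ p := Nat.cast_nonneg p
  have hpq : Real.HolderConjugate ((p + 2 : ℕ) : ℝ) (((p : ℝ) + 2) / (p + 1)) := by
    rw [Real.holderConjugate_iff]
    push_cast
    refine ⟨by linarith, ?_⟩
    field_simp
    ring
  -- Hölder for the constant `1` and `y^{k-1}`, with exponents `k` and `k/(k-1)`.
  have h := Real.inner_le_Lp_mul_Lq_of_nonneg Finset.univ hpq (f := fun _ : Fin n => (1 : ℝ))
    (g := fun l => y l ^ (p + 1)) (fun _ _ => zero_le_one) (fun l _ => pow_nonneg (hy.1 l) _)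
  have hpow : ∀ l, (y l ^ (p + 1)) ^ (((p : ℝ) + 2) / (p + 1)) = y l ^ (p + 2) := fun l => by
    rw [← Real.rpow_natCast, ← Real.rpow_mul (hy.1 l), ← Real.rpow_natCast]
    congr 1
    push_cast
    field_simp
  simp only [one_mul, Real.one_rpow, hpow, Finset.sum_const, Finset.card_univ, Fintype.card_fin,
    nsmul_eq_mul, mul_one] at h
  have he : (1 : ℝ) / (((p : ℝ) + 2) / (p + 1)) = -(1 / ((p + 2 : ℕ) : ℝ) - 1) := by
    push_cast
    field_simp
    ring
  rw [he] at h
  have hσ : 0 < powerSum (p + 2) y ^ (1 / ((p + 2 : ℕ) : ℝ) - 1) := Real.rpow_pos_of_pos hs _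
  refine (mul_le_mul_of_nonneg_left h hσ.le).trans_eq ?_
  rw [show ∑ l, y l ^ (p + 2) = powerSum (p + 2) y from rfl, Real.rpow_neg hs.le,
    mul_left_comm, mul_inv_cancel₀ hσ.ne', mul_one]

/-- Cauchy-Schwarz gives `(∑ g y)² ≤ (∑ g)(∑ g y²)` for the weights `g = 1 + t σ y^{k-1}`,
proportional to the partial derivatives; the power mean inequality bounds `∑ g`. -/
theorem le_curvRatio {t : ℝ} (ht : 0 ≤ t) :
    (1 + t) / (n + t * (n : ℝ) ^ (1 / ((p + 2 : ℕ) : ℝ))) ≤ curvRatio t p y := by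
  rw [curvRatio_eq hy p ht]
  have hs := powerSum_pos hy (p + 2)
  have hσs := rpow_sub_one_mul_powerSum hy p
  have hmean := rpow_mul_powerSum_pred_le hy p
  have hS1 : 0 < ∑ l, y l := by simpa [powerSum] using powerSum_pos hy 1
  have hσ0 : 0 ≤ powerSum (p + 2) y ^ (1 / ((p + 2 : ℕ) : ℝ) - 1) := Real.rpow_nonneg hs.le _
  have hN0 : 0 ≤ powerSum (p + 2) y ^ (1 / ((p + 2 : ℕ) : ℝ)) := Real.rpow_nonneg hs.le _
  set σ := powerSum (p + 2) y ^ (1 / ((p + 2 : ℕ) : ℝ) - 1)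
  set N := powerSum (p + 2) y ^ (1 / ((p + 2 : ℕ) : ℝ))
  set S := ∑ l, y l with hS
  have hg : ∀ l, 0 ≤ 1 + t * (σ * y l ^ (p + 1)) := fun l => by
    have := pow_nonneg (hy.1 l) (p + 1)
    positivity
  have hcs := Finset.sum_sq_le_sum_mul_sum_of_sq_le_mul Finset.univ
    (r := fun l => (1 + t * (σ * y l ^ (p + 1))) * y l)
    (f := fun l => 1 + t * (σ * y l ^ (p + 1)))
    (g := fun l => (1 + t * (σ * y l ^ (p + 1))) * y l ^ 2) (fun l _ => hg l)
    (fun l _ => mul_nonneg (hg l) (sq_nonneg _)) (fun l _ => le_of_eq (by ring))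
  have e1 : ∑ l, (1 + t * (σ * y l ^ (p + 1))) * y l = S + t * N := by
    rw [← hσs, hS, powerSum]
    simp only [Finset.mul_sum, ← Finset.sum_add_distrib]
    exact Finset.sum_congr rfl fun l _ => by ring
  have e2 : ∑ l, (1 + t * (σ * y l ^ (p + 1))) = n + t * (σ * powerSum (p + 1) y) := by
    rw [Finset.sum_add_distrib, powerSum]
    simp [Finset.mul_sum]
  have e3 : ∑ l, (1 + t * (σ * y l ^ (p + 1))) * y l ^ 2 =
      powerSum 2 y + t * (σ * powerSum (p + 3) y) := by
    simp only [powerSum, Finset.mul_sum, ← Finset.sum_add_distrib]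
    exact Finset.sum_congr rfl fun l _ => by ring
  have hn : (0 : ℝ) < n := by
    obtain ⟨-, l, -⟩ := hy
    exact_mod_cast l.pos
  have hnk : 0 < (n : ℝ) ^ (1 / ((p + 2 : ℕ) : ℝ)) := Real.rpow_pos_of_pos hn _
  have h3 : 0 ≤ powerSum 2 y + t * (σ * powerSum (p + 3) y) := by
    rw [← e3]
    exact Finset.sum_nonneg fun l _ => mul_nonneg (hg l) (sq_nonneg _)
  rw [e1, e2, e3] at hcs
  have h4 : (S + t * N) ^ 2 ≤ (n + t * (n : ℝ) ^ (1 / ((p + 2 : ℕ) : ℝ))) *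
      (powerSum 2 y + t * (σ * powerSum (p + 3) y)) :=
    hcs.trans (mul_le_mul_of_nonneg_right (by gcongr) h3)
  rw [div_le_div_iff₀ (by positivity) (by positivity)]
  calc (1 + t) * (S + t * N) ^ 2 ≤ (1 + t) * ((n + t * (n : ℝ) ^ (1 / ((p + 2 : ℕ) : ℝ))) *
      (powerSum 2 y + t * (σ * powerSum (p + 3) y))) := by gcongr
    _ = _ := by ring

theorem tendsto_curvRatio_zero : Filter.Tendsto (fun t => curvRatio t p y) (𝓝[>] 0)
    (𝓝 (powerSum 2 y / (∑ l, y l) ^ 2)) := by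
  have hS1 : 0 < ∑ l, y l := by simpa [powerSum] using powerSum_pos hy 1
  set σ := powerSum (p + 2) y ^ (1 / ((p + 2 : ℕ) : ℝ) - 1) with hσ
  set N := powerSum (p + 2) y ^ (1 / ((p + 2 : ℕ) : ℝ)) with hN
  have hcont : ContinuousAt (fun t : ℝ => (1 + t) * (powerSum 2 y +
      t * (σ * powerSum (p + 3) y)) / (∑ l, y l + t * N) ^ 2) 0 := by
    refine ContinuousAt.div (by fun_prop) (by fun_prop) ?_
    simpa using hS1.ne'
  have h := hcont.tendsto.mono_left (nhdsWithin_le_nhds (s := Set.Ioi 0))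
  simp only [add_zero, one_mul, zero_mul] at h
  refine h.congr' ?_
  filter_upwards [self_mem_nhdsWithin] with t ht
  exact (curvRatio_eq hy p (le_of_lt ht)).symm

theorem tendsto_curvRatio_atTop : Filter.Tendsto (fun t => curvRatio t p y) Filter.atTop
    (𝓝 (powerSum (p + 3) y / powerSum (p + 2) y ^ (1 / ((p + 2 : ℕ) : ℝ) + 1))) := by
  have hs := powerSum_pos hy (p + 2)
  have hlim : powerSum (p + 3) y / powerSum (p + 2) y ^ (1 / ((p + 2 : ℕ) : ℝ) + 1) =
      powerSum (p + 2) y ^ (1 / ((p + 2 : ℕ) : ℝ) - 1) * powerSum (p + 3) y /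
        (powerSum (p + 2) y ^ (1 / ((p + 2 : ℕ) : ℝ))) ^ 2 := by
    have hN : 0 < powerSum (p + 2) y ^ (1 / ((p + 2 : ℕ) : ℝ)) := Real.rpow_pos_of_pos hs _
    rw [Real.rpow_add_one hs.ne', Real.rpow_sub_one hs.ne']
    field_simp
  rw [hlim]
  have hN : 0 < powerSum (p + 2) y ^ (1 / ((p + 2 : ℕ) : ℝ)) := Real.rpow_pos_of_pos hs _
  have heq := fun t ht => curvRatio_eq hy p (t := t) ht
  set σ := powerSum (p + 2) y ^ (1 / ((p + 2 : ℕ) : ℝ) - 1)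
  set N := powerSum (p + 2) y ^ (1 / ((p + 2 : ℕ) : ℝ))
  -- With `u = 1/t`, numerator and denominator divided by `t²` extend continuously to `u = 0`.
  have hcont : ContinuousAt (fun u : ℝ => (u + 1) * (u * powerSum 2 y +
      σ * powerSum (p + 3) y) / (u * ∑ l, y l + N) ^ 2) 0 := by
    refine ContinuousAt.div (by fun_prop) (by fun_prop) ?_
    simpa using hN.ne'
  have h := hcont.tendsto.comp tendsto_inv_atTop_zero
  simp only [zero_add, one_mul, zero_mul] at h
  refine h.congr' ?_
  filter_upwards [Filter.eventually_gt_atTop 0] with t ht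
  rw [heq t ht.le]
  simp only [Function.comp_apply]
  have hS1 : 0 < ∑ l, y l := by simpa [powerSum] using powerSum_pos hy 1
  field_simp

end Bounds

/-! ### The curvature formula and the theorem -/

section CurvatureFormula

variable {n : ℕ} {m : Fin n → ℕ} {M : Fin n → Type*} [∀ l, TopologicalSpace (M l)]
  [∀ l, ChartedSpace (Fin (m l) → ℂ) (M l)] [∀ l, IsManifold 𝓘(ℂ, Fin (m l) → ℂ) ω (M l)]

theorem prodFinsler_sq (Q : ∀ l, HermitianMetric 𝓘(ℂ, Fin (m l) → ℂ) (M l)) {t : ℝ} (ht : 0 ≤ t)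
    (k : ℕ) (v : TangentBundle (prodModel m) (∀ l, M l)) :
    prodFinsler Q t k v ^ 2 = mixedNorm t k (quadValues Q v) := by
  have h0 : ∀ l, 0 ≤ (Q l).quad (projTangent m M l v) := fun l => (Q l).quad_nonneg _
  have h1 : 0 ≤ ∑ l, (Q l).quad (projTangent m M l v) := Finset.sum_nonneg fun l _ => h0 l
  have h2 : 0 ≤ (∑ l, (Q l).quad (projTangent m M l v) ^ k) ^ (1 / (k : ℝ)) :=
    Real.rpow_nonneg (Finset.sum_nonneg fun l _ => pow_nonneg (h0 l) k) _
  rw [prodFinsler, mul_pow, div_pow, one_pow, Real.sq_sqrt (by positivity),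
    Real.sq_sqrt (by positivity)]
  rfl

theorem holSecCurv_prodFinsler {Q : ∀ l, HermitianMetric 𝓘(ℂ, Fin (m l) → ℂ) (M l)} {c : ℝ}
    (hc : ∀ (l : Fin n) (v : TangentBundle 𝓘(ℂ, Fin (m l) → ℂ) (M l)), v.2 ≠ 0 →
      holSecCurv 𝓘(ℂ, Fin (m l) → ℂ) (factorBasis (m l)) (Q l).finsler v = c)
    {t : ℝ} (ht : 0 ≤ t) (p : ℕ) {v : TangentBundle (prodModel m) (∀ l, M l)} (hv : v.2 ≠ 0) :
    holSecCurv (prodModel m) (prodBasis m) (prodFinsler Q t (p + 2)) v =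
      c * curvRatio t p (quadValues Q v) := by
  rw [holSecCurv_product hc (isConvexIncreasing_mixedNorm ht p)
    (fun v => prodFinsler_sq Q ht (p + 2) v) hv, curvRatio, mul_div_assoc]

end CurvatureFormula

theorem mainTheorem9 (n : ℕ) (m : Fin n → ℕ) (M : Fin n → Type*)
    [∀ l, TopologicalSpace (M l)] [∀ l, ChartedSpace (Fin (m l) → ℂ) (M l)]
    [∀ l, IsManifold 𝓘(ℂ, Fin (m l) → ℂ) ω (M l)]
    (Q : ∀ l, HermitianMetric 𝓘(ℂ, Fin (m l) → ℂ) (M l)) (k : ℕ) (hk : 2 ≤ k) (c : ℝ)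
    (hc : ∀ (l : Fin n) (v : TangentBundle 𝓘(ℂ, Fin (m l) → ℂ) (M l)), v.2 ≠ 0 →
      holSecCurv 𝓘(ℂ, Fin (m l) → ℂ) (factorBasis (m l)) (Q l).finsler v = c) :
    (0 < c → ∀ t : ℝ, 0 ≤ t → ∀ v : TangentBundle (prodModel m) (∀ l, M l), v.2 ≠ 0 →
      (1 + t) * c / (n + t * (n : ℝ) ^ (1 / (k : ℝ))) ≤
        holSecCurv (prodModel m) (prodBasis m) (prodFinsler Q t k) v ∧
      holSecCurv (prodModel m) (prodBasis m) (prodFinsler Q t k) v ≤ c) ∧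
    (c < 0 → ∀ t : ℝ, 0 ≤ t → ∀ v : TangentBundle (prodModel m) (∀ l, M l), v.2 ≠ 0 →
      c ≤ holSecCurv (prodModel m) (prodBasis m) (prodFinsler Q t k) v ∧
      holSecCurv (prodModel m) (prodBasis m) (prodFinsler Q t k) v ≤
        (1 + t) * c / (n + t * (n : ℝ) ^ (1 / (k : ℝ)))) ∧
    (c = 0 → ∀ t : ℝ, 0 ≤ t → ∀ v : TangentBundle (prodModel m) (∀ l, M l), v.2 ≠ 0 →
      holSecCurv (prodModel m) (prodBasis m) (prodFinsler Q t k) v = 0) ∧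
    (∀ v : TangentBundle (prodModel m) (∀ l, M l), v.2 ≠ 0 →
      Filter.Tendsto (fun t => holSecCurv (prodModel m) (prodBasis m) (prodFinsler Q t k) v)
        (𝓝[>] 0)
        (𝓝 (c * ((∑ l, (Q l).quad (projTangent m M l v) ^ 2) /
          (∑ l, (Q l).quad (projTangent m M l v)) ^ 2))) ∧
      Filter.Tendsto (fun t => holSecCurv (prodModel m) (prodBasis m) (prodFinsler Q t k) v)
        Filter.atTop
        (𝓝 (c * ((∑ l, (Q l).quad (projTangent m M l v) ^ (k + 1)) /
          (∑ l, (Q l).quad (projTangent m M l v) ^ k) ^ (1 / (k : ℝ) + 1))))) := by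

  -- Writing `k = p + 2` keeps the exponents `k - 2` and `k - 1` natural, so the second derivatives
  -- make sense also where some `Q_l` vanish.
  obtain ⟨p, rfl⟩ : ∃ p, k = p + 2 := ⟨k - 2, by omega⟩
  refine ⟨fun hpos t ht v hv => ?_, fun hneg t ht v hv => ?_, fun hzero t ht v hv => ?_,
    fun v hv => ?_⟩
  · have hy := quadValues_mem (Q := Q) hv
    rw [holSecCurv_prodFinsler hc ht p hv, mul_comm (1 + t) c, mul_div_assoc]
    exact ⟨mul_le_mul_of_nonneg_left (le_curvRatio hy p ht) hpos.le,
      mul_le_of_le_one_right hpos.le (curvRatio_le_one hy p ht)⟩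
  · have hy := quadValues_mem (Q := Q) hv
    rw [holSecCurv_prodFinsler hc ht p hv, mul_comm (1 + t) c, mul_div_assoc]
    refine ⟨?_, mul_le_mul_of_nonpos_left (le_curvRatio hy p ht) hneg.le⟩
    simpa using mul_le_mul_of_nonpos_left (curvRatio_le_one hy p ht) hneg.le
  · rw [holSecCurv_prodFinsler hc ht p hv, hzero, zero_mul]
  · have hy := quadValues_mem (Q := Q) hv
    refine ⟨((tendsto_curvRatio_zero hy p).const_mul c).congr' ?_,
      ((tendsto_curvRatio_atTop hy p).const_mul c).congr' ?_⟩
    · filter_upwards [self_mem_nhdsWithin] with t ht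
      exact (holSecCurv_prodFinsler hc (le_of_lt ht) p hv).symm
    · filter_upwards [Filter.eventually_ge_atTop 0] with t ht
      exact (holSecCurv_prodFinsler hc ht p hv).symm
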